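/- **Setting.** A bidder takes part in $T\ge 1$ auctions with total budget $B>0$. The request of round $t$ is $\gamma_t=(z_t,v_t,x_t,p_t)$: a feature $z_t$, a value $v_t\in(0,1]$, and a truthful auction, i.e. functions $x_t,p_t:\mathbb R_{\ge0}\to[0,1]$ of the bid (winning probability and payment) with $p_t(0)=0$ and $w\,x_t(b)-p_t(b)\le w\,x_t(w)-p_t(w)$ for all $w,b\ge0$. The requests $\gamma_1,\dots,\gamma_T$ are independent with laws $\mathcal P_1,\dots,\mathcal P_T$, $\vec{\mathcal P}=\prod_t\mathcal P_t$, and $\mathrm{MD}(\vec{\mathcal P})=\sum_{t=1}^T\|\mathcal P_t-\frac1T\sum_{s=1}^T\mathcal P_s\|_{\mathrm{TV}}$. The history $\mathcal D$ consists of training data and calibration data $(z_j^*,v_j^*)_{j=1}^n$ with $v_j^*\in[0,1]$; all its points are independent of each other and of the requests, not necessarily identically distributed. **Adjusted values.** Let $\alpha\in(0,1)$. A predictor $\hat\mu$ with values in $[0,1]$ is fitted to the training data. For each $t$ let weights $\tilde\omega^t_1,\dots,\tilde\omega^t_{n+1}\ge0$ of sum $1$ be given with $\tilde\omega^t_j\le\tilde\omega^t_{n+1}\le\alpha/T$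 for $j\le n$, such that $\tilde\omega_j^t>0$ only if the calibration point $j$ has the same distribution as $(z_t,v_t)$. Let $d_t$ be the $(1-\alpha/T)$-quantile of $\sum_{j=1}^n\tilde\omega^t_j\delta_{v_j^*-\hat\mu(z_j^*)}+\tilde\omega^t_{n+1}\delta_{+\infty}$ (which lies in $[-1,1]$), and $\hat v_t=\hat\mu(z_t)+d_t$. Put $\xi=d_{\max}/v_{\min}$, $d_{\max}=\max_t|\hat v_t-v_t|$, $v_{\min}=\min_t v_t$. **Algorithm.** Start with $\lambda_1=1$, $\mu_1=0$, $B_1=B$. In round $t$ bid $b_t=\max\{0,\frac{1+\lambda_t}{\mu_t+\lambda_t}\hat v_t\}$ if $B_t\ge1$ and $b_t=0$ otherwise; then set $\lambda_{t+1}=\lambda_t\exp[-\phi(\hat v_tx_t(b_t)-p_t(b_t))]$, $\mu_{t+1}=\max\{0,\mu_t-\eta(B/T-p_t(b_t))\}$, $B_{t+1}=B_t-p_t(b_t)$, where $\phi=1/\sqrt T$ and $\eta=1/((1+(B/T)^2)\sqrt T)$. Its reward is $\mathrm{Reward}(\mathrm{Alg},\vec\gamma)=\sum_tv_tx_t(b_t)$.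 $\mathrm{Reward}(\mathrm{OPT},\vec\gamma)$ is the supremum of $\sum_tv_tx_t(b'_t)$ over all bids $b'\in\mathbb R_{\ge0}^T$ with $\sum_tp_t(b'_t)\le B$ and $\sum_tp_t(b'_t)\le\sum_tv_tx_t(b'_t)$. **Theorem.** For all constants $c,C,K$ with $c>0$ there is a constant $M$, depending only on $c,C,K$, such that whenever $c\le B/T\le C$ and $\mathrm{MD}(\vec{\mathcal P})\le K$: 1. With probability at least $1-\alpha$ over the history $\mathcal D$, $$\mathbb E_{\vec\gamma\sim\vec{\mathcal P}}\Big[\tfrac1{1+\xi}\mathrm{Reward}(\mathrm{OPT},\vec\gamma)-\mathrm{Reward}(\mathrm{Alg},\vec\gamma)\Big]\le M\sqrt T .$$ (If the integrand is not measurable, the expectation is the outer one.) 2. For every history and every sequence of requests, $\sum_{t=1}^Tp_t(b_t)\le B$. 3. For every history and every sequence of requests, if $T\ge2$, $$\sum_{t=1}^Tp_t(b_t)-(1+\xi)\sum_{t=1}^Tv_tx_t(b_t)\le M\sqrt T\log T .$$ -/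

import Mathlib

open MeasureTheory unitInterval
open scoped NNReal

noncomputable section

/-! ## Truthful auctions and auction requests -/

/-- A truthful single-slot auction seen by one bidder: the winning probability `alloc b` and the
(expected) payment `pay b` as functions of the bid `b ≥ 0`. A zero bid pays nothing, and bidding
one's value maximizes the utility, whatever the value. -/
structure TruthfulAuction where
  alloc : ℝ≥0 → ℝ
  pay : ℝ≥0 → ℝ
  alloc_mem : ∀ b, alloc b ∈ Set.Icc (0 : ℝ) 1
  pay_mem : ∀ b, pay b ∈ Set.Icc (0 : ℝ) 1
  pay_zero : pay 0 = 0
  truthful : ∀ w b : ℝ≥0, (w : ℝ) * alloc b - pay b ≤ (w : ℝ) * alloc w - pay w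

/-- A data point: contextual feature and value. -/
abbrev DataPoint (Z : Type*) := Z × I

/-- An auction request `(z, v, (x, p))`: feature, value, allocation and payment functions. -/
abbrev Request (Z : Type*) := Z × I × TruthfulAuction

namespace Request
variable {Z : Type*}

/-- The contextual feature. -/
def feature (γ : Request Z) : Z := γ.1

/-- The bidder's value. -/
def value (γ : Request Z) : ℝ := (γ.2.1 : ℝ)

/-- The auction. -/
def auction (γ : Request Z) : TruthfulAuction := γ.2.2

/-- The pair of feature and value. -/
def dataPoint (γ : Request Z) : DataPoint Z := (γ.1, γ.2.1)

end Request

/-! ## Total variation and mean deviation -/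

/-- Total variation distance `sup_A |μ(A) - ν(A)|` over measurable sets `A`. -/
def tvDist {Ω : Type*} [MeasurableSpace Ω] (μ ν : Measure Ω) : ℝ :=
  ⨆ A : {A : Set Ω // MeasurableSet A}, |μ.real A.1 - ν.real A.1|

/-- The time average `(1/T) ∑ₛ P s`. -/
def averageLaw {Ω : Type*} [MeasurableSpace Ω] {T : ℕ} (P : Fin T → Measure Ω) : Measure Ω :=
  (T : ENNReal)⁻¹ • ∑ s, P s

/-- Mean deviation: the sum over `t` of the total variation distance from `P t` to the average. -/
def meanDeviation {Ω : Type*} [MeasurableSpace Ω] {T : ℕ} (P : Fin T → Measure Ω) : ℝ :=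
  ∑ t, tvDist (P t) (averageLaw P)

/-! ## Upper bounds on expectations -/

/-- "The (outer) expectation of `f` under `P` is at most `c`": `f` has an integrable majorant whose
expectation is at most `c`. For integrable `f` this says `∫ f ≤ c`, see
`expectationLE_iff`; it is meaningful without any measurability of `f`. -/
def ExpectationLE {Ω : Type*} [MeasurableSpace Ω] (P : Measure Ω) (f : Ω → ℝ) (c : ℝ) : Prop :=
  ∃ h : Ω → ℝ, Integrable h P ∧ (∀ᵐ ω ∂P, f ω ≤ h ω) ∧ ∫ ω, h ω ∂P ≤ c

theorem expectationLE_iff {Ω : Type*} [MeasurableSpace Ω] {P : Measure Ω} {f : Ω → ℝ} {c : ℝ}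
    (hf : Integrable f P) : ExpectationLE P f c ↔ ∫ ω, f ω ∂P ≤ c :=
  ⟨fun ⟨_, hh, hle, hc⟩ => (integral_mono_ae hf hh hle).trans hc,
    fun hc => ⟨f, hf, Filter.Eventually.of_forall fun _ => le_rfl, hc⟩⟩

/-! ## Split conformal prediction with weighted quantiles -/

/-- The `τ`-quantile of `∑ⱼ ω j • δ_{s j} + ωInf • δ_{+∞}`: the least `q` in the extended reals at
which the cumulative mass reaches `τ`. -/
def weightedQuantile {n : ℕ} (τ : ℝ) (ω : Fin n → ℝ) (ωInf : ℝ) (s : Fin n → ℝ) : EReal :=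
  open Classical in
  sInf {q : EReal | τ ≤ (∑ j, if (s j : EReal) ≤ q then ω j else 0) + if q = ⊤ then ωInf else 0}

/-- The historical data after the split into training and calibration data. -/
abbrev History (Z : Type*) (m n : ℕ) := (Fin m → DataPoint Z) × (Fin n → DataPoint Z)

/-- The adjusted predicted value `v̂ = μ̂(z) + d` of a request with feature `z`. Here `μ̂` is fitted
by the learning procedure `learn` to the training data, and `d` is the `(1 - β)`-quantile of the
scores `v* - μ̂(z*)` of the calibration data with the given weights. -/
def adjustedValue {Z : Type*} {m n : ℕ} (learn : (Fin m → DataPoint Z) → Z → I) (β : ℝ)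
    (ω : Fin n → ℝ) (ωInf : ℝ) (D : History Z m n) (z : Z) : ℝ :=
  (learn D.1 z : ℝ) +
    (weightedQuantile (1 - β) ω ωInf
      (fun j => ((D.2 j).2 : ℝ) - (learn D.1 (D.2 j).1 : ℝ))).toReal

/-- Weights admissible for a request law `P` and calibration laws `Qcal`: weights `ω j` of the
calibration points and `ωInf` of `+∞` that are nonnegative and sum to one, no calibration point
weighing more than the test point (whose score is replaced by `+∞`); only calibration points with
the same law as the feature-value pair of the request have positive weight; and the mass at `+∞`
is at most `β`, that is, the `(1 - β)`-quantile is finite. -/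
def AdmissibleWeights {Z : Type*} [MeasurableSpace Z] [MeasurableSpace TruthfulAuction] {n : ℕ}
    (β : ℝ) (Qcal : Fin n → Measure (DataPoint Z)) (P : Measure (Request Z))
    (ω : Fin n → ℝ) (ωInf : ℝ) : Prop :=
  (∀ j, 0 ≤ ω j ∧ ω j ≤ ωInf) ∧ (∑ j, ω j) + ωInf = 1 ∧
    (∀ j, 0 < ω j → Qcal j = P.map Request.dataPoint) ∧ ωInf ≤ β

/-! ## The online bidding algorithm -/

/-- RoS multiplier `lam`, budget multiplier `mu` and leftover budget. -/
structure DualState where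
  lam : ℝ
  mu : ℝ
  budget : ℝ

/-- The bid in a given state for adjusted value `vhat`: `(1 + λ)/(μ + λ) · vhat` if the leftover
budget is at least `1`, and `0` otherwise (bids are nonnegative: a negative number is replaced
by `0`). -/
def DualState.bid (S : DualState) (vhat : ℝ) : ℝ≥0 :=
  open Classical in
  if 1 ≤ S.budget then Real.toNNReal ((1 + S.lam) / (S.mu + S.lam) * vhat) else 0

/-- One round: bid, observe allocation and payment, and update the multipliers, with step sizes
`φ = 1/√T` and `η = 1/((1 + (B/T)²)√T)`. -/
def DualState.step (T : ℕ) (B : ℝ) (S : DualState) (vhat : ℝ) (A : TruthfulAuction) : DualState :=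
  let b := S.bid vhat
  { lam := S.lam * Real.exp (-(1 / √(T : ℝ)) * (vhat * A.alloc b - A.pay b))
    mu := max 0 (S.mu - 1 / ((1 + (B / T) ^ 2) * √(T : ℝ)) * (B / T - A.pay b))
    budget := S.budget - A.pay b }

/-- The state after the first `t` rounds. -/
def algState {T : ℕ} (B : ℝ) (vhat : Fin T → ℝ) (A : Fin T → TruthfulAuction) : ℕ → DualState
  | 0 => { lam := 1, mu := 0, budget := B }
  | t + 1 =>
    if h : t < T then (algState B vhat A t).step T B (vhat ⟨t, h⟩) (A ⟨t, h⟩)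
    else algState B vhat A t

/-- The bids of the algorithm. -/
def algBid {T : ℕ} (B : ℝ) (vhat : Fin T → ℝ) (A : Fin T → TruthfulAuction) (t : Fin T) : ℝ≥0 :=
  (algState B vhat A t).bid (vhat t)

/-! ## Reward, payment, hindsight optimum -/

section Offline
variable {Z : Type*} {T : ℕ}

/-- Total reward `∑ₜ vₜ xₜ(bₜ)`. -/
def reward (b : Fin T → ℝ≥0) (γ : Fin T → Request Z) : ℝ :=
  ∑ t, (γ t).value * (γ t).auction.alloc (b t)

/-- Total payment `∑ₜ pₜ(bₜ)`. -/
def payment (b : Fin T → ℝ≥0) (γ : Fin T → Request Z) : ℝ :=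
  ∑ t, (γ t).auction.pay (b t)

/-- Bids that satisfy the budget constraint and the RoS constraint (with true values). -/
def Feasible (B : ℝ) (γ : Fin T → Request Z) (b : Fin T → ℝ≥0) : Prop :=
  payment b γ ≤ B ∧ payment b γ ≤ reward b γ

/-- The hindsight optimal reward: the supremum of the reward of feasible bids. -/
def optReward (B : ℝ) (γ : Fin T → Request Z) : ℝ :=
  sSup ((fun b => reward b γ) '' {b | Feasible B γ b})

/-- `ξ = d_max / v_min`, with `d_max = maxₜ |v̂ₜ - vₜ|` and `v_min = minₜ vₜ`. -/
def xi (vhat : Fin T → ℝ) (γ : Fin T → Request Z) : ℝ :=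
  (⨆ t, |vhat t - (γ t).value|) / ⨅ t, (γ t).value

/-- The adjusted values of a sequence of requests, given the history; the weights of round `t` are
`ω t` and `ωInf t`. -/
def adjustedValues {m n : ℕ} (learn : (Fin m → DataPoint Z) → Z → I) (β : ℝ)
    (ω : Fin T → Fin n → ℝ) (ωInf : Fin T → ℝ) (D : History Z m n) (γ : Fin T → Request Z) :
    Fin T → ℝ :=
  fun t => adjustedValue learn β (ω t) (ωInf t) D (γ t).feature

/-- The bids of the algorithm run on a sequence of requests with adjusted values `vhat`. -/
def algBids (B : ℝ) (vhat : Fin T → ℝ) (γ : Fin T → Request Z) : Fin T → ℝ≥0 :=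
  algBid B vhat (fun t => (γ t).auction)

end Offline

end

/-!
The regret bound compares the algorithm with the Lagrangian dual of the hindsight problem. By
truthfulness, the bid `(1 + λ) / (μ + λ) * w` maximizes the Lagrangian of a round with value `w`
(`TruthfulAuction.lagrangian_le`), so that `dualValue` is the dual objective of a round and bounds the
optimum (`optReward_le_dual`), while the reward of the algorithm is its own dual objective up to the
regrets of the two multipliers (`sum_mu_regret_le`, `sum_lam_regret_le`). These are of order `√T`,
since `λ` stays of order `√T` (`lam_le_of_active`) as long as at most `√T` rounds are underestimated,
that is, have `v̂ₜ < vₜ`. Each underestimated round costs another `O(√T)`. Altogether, on every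
sequence of requests the regret is at most a sum of differences of dual objectives, one for each
round, at fixed multipliers and at those of the algorithm (`regret_le_sum_dualGap`).

For fixed multipliers that nearly minimize the dual objective of the average law, each of these
differences has nonpositive expectation given the past, up to a total variation term of order `√T`
times the distance from `P t` to the average. The weight `1 / (1 + ξ)` in front depends on all rounds,
however. It is a function of a maximum and a minimum over the rounds, so that at most two rounds
influence it (`sum_looWeight_sub_le`): each difference may be multiplied by the weight that leaves out
its own round, at a total cost of order `√T`, and this weight is independent of the round
(`integral_looWeight_mul_dualGap_le`, `expectationLE_regret`).

It remains to bound the expected number of underestimated rounds given the history. By the coverage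
property of weighted split conformal prediction (`pi_coverage`, an exchange of the test point with a
calibration point of the same law), each round is underestimated with probability at most `α / T`.
By Markov's inequality, with probability at least `1 - α` over the history the conditional expectation
of their number is at most one (`exists_good_histories`).

The budget constraint holds since a bid is made only while the budget can pay for it. The
return-on-spend constraint holds since `√T log λ` accumulates the violation, measured with the
adjusted values, and since a round with `λ > √T` adds only `2 / √T` to it (`sum_violation_le`).
-/

/-! ### Truthful auctions and the bids of a dual state -/

namespace TruthfulAuction

lemma alloc_nonneg (A : TruthfulAuction) (b : ℝ≥0) : 0 ≤ A.alloc b := (A.alloc_mem b).1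
lemma alloc_le_one (A : TruthfulAuction) (b : ℝ≥0) : A.alloc b ≤ 1 := (A.alloc_mem b).2
lemma pay_nonneg (A : TruthfulAuction) (b : ℝ≥0) : 0 ≤ A.pay b := (A.pay_mem b).1
lemma pay_le_one (A : TruthfulAuction) (b : ℝ≥0) : A.pay b ≤ 1 := (A.pay_mem b).2

/-- Individual rationality: a truthful bid is at least as good as the bid `0`. -/
lemma pay_le_mul_alloc (A : TruthfulAuction) (b : ℝ≥0) : A.pay b ≤ b * A.alloc b := by
  have h := A.truthful b 0
  rw [A.pay_zero] at h
  have := mul_nonneg b.2 (A.alloc_nonneg 0)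
  change 0 ≤ (b : ℝ) * A.alloc 0 at this
  linarith

/-- By truthfulness, the bid `(1 + λ) / (μ + λ) * w` maximizes the Lagrangian of a round. -/
lemma lagrangian_le (A : TruthfulAuction) {lam mu w : ℝ} (hlam : 0 < lam) (hmu : 0 ≤ mu)
    (hw : 0 ≤ w) (b : ℝ≥0) :
    (1 + lam) * w * A.alloc b - (lam + mu) * A.pay b ≤
      (1 + lam) * w * A.alloc (Real.toNNReal ((1 + lam) / (mu + lam) * w)) -
        (lam + mu) * A.pay (Real.toNNReal ((1 + lam) / (mu + lam) * w)) := by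
  have hpos : 0 < mu + lam := by linarith
  have h := A.truthful (Real.toNNReal ((1 + lam) / (mu + lam) * w)) b
  set b' := Real.toNNReal ((1 + lam) / (mu + lam) * w) with hb'
  have hb : (mu + lam) * (b' : ℝ) = (1 + lam) * w := by
    rw [hb', Real.coe_toNNReal _ (by positivity)]
    field_simp
  have h2 := mul_le_mul_of_nonneg_left h hpos.le
  rw [← hb]
  linarith

end TruthfulAuction

namespace DualState

lemma bid_of_budget_lt (S : DualState) (w : ℝ) (h : S.budget < 1) : S.bid w = 0 := by
  simp [DualState.bid, not_le.2 h]

lemma bid_of_le_budget (S : DualState) (w : ℝ) (h : 1 ≤ S.budget) :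
    S.bid w = Real.toNNReal ((1 + S.lam) / (S.mu + S.lam) * w) := by
  simp [DualState.bid, h]

lemma bid_of_nonpos (S : DualState) {w : ℝ} (hlam : 0 < S.lam) (hmu : 0 ≤ S.mu) (hw : w ≤ 0) :
    S.bid w = 0 := by
  by_cases h : 1 ≤ S.budget
  · rw [S.bid_of_le_budget w h, Real.toNNReal_eq_zero]
    exact mul_nonpos_of_nonneg_of_nonpos (by positivity) hw
  · exact S.bid_of_budget_lt w (not_le.1 h)

/-- A large RoS multiplier keeps the RoS violation of a round small: it is at most `w / λ`. -/
lemma lam_mul_loss_le (S : DualState) (A : TruthfulAuction) {w : ℝ} (hlam : 0 < S.lam)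
    (hmu : 0 ≤ S.mu) (hw : 0 ≤ w) :
    S.lam * (A.pay (S.bid w) - w * A.alloc (S.bid w)) ≤ w * A.alloc (S.bid w) := by
  have hx := mul_nonneg hw (A.alloc_nonneg (S.bid w))
  by_cases h : 1 ≤ S.budget
  · have hp := A.pay_le_mul_alloc (S.bid w)
    have hb : (S.mu + S.lam) * (S.bid w : ℝ) = (1 + S.lam) * w := by
      rw [S.bid_of_le_budget w h, Real.coe_toNNReal _ (by positivity)]
      field_simp
    have h1 := mul_le_mul_of_nonneg_left hp (by positivity : 0 ≤ S.mu + S.lam)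
    rw [← mul_assoc, hb] at h1
    have h2 := mul_nonneg hmu (A.pay_nonneg (S.bid w))
    linarith
  · have hb := S.bid_of_budget_lt w (not_le.1 h)
    rw [hb] at hx ⊢
    rw [A.pay_zero]
    have := mul_nonneg hlam.le hx
    linarith

end DualState

/-! ### The run of the algorithm -/

section Run
variable {T : ℕ} (B : ℝ) (vhat : Fin T → ℝ) (A : Fin T → TruthfulAuction)

/-- The RoS slack `v̂ₜ xₜ(bₜ) - pₜ(bₜ)` of a round, measured with the adjusted value. -/
noncomputable def slack (t : Fin T) : ℝ :=
  vhat t * (A t).alloc (algBid B vhat A t) - (A t).pay (algBid B vhat A t)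

lemma algState_succ (t : Fin T) :
    algState B vhat A (t + 1) = (algState B vhat A t).step T B (vhat t) (A t) := by
  simp [algState]

lemma lam_succ (t : Fin T) : (algState B vhat A (t + 1)).lam =
    (algState B vhat A t).lam * Real.exp (-(1 / √(T : ℝ)) * slack B vhat A t) := by
  rw [algState_succ]; rfl

lemma mu_succ (t : Fin T) : (algState B vhat A (t + 1)).mu =
    max 0 ((algState B vhat A t).mu - 1 / ((1 + (B / T) ^ 2) * √(T : ℝ)) *
      (B / T - (A t).pay (algBid B vhat A t))) := by
  rw [algState_succ]; rfl

lemma budget_succ (t : Fin T) : (algState B vhat A (t + 1)).budget =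
    (algState B vhat A t).budget - (A t).pay (algBid B vhat A t) := by
  rw [algState_succ]; rfl

/-- Induction along the rounds; after the last round the state no longer changes. -/
lemma algState_induction {p : ℕ → DualState → Prop} (h0 : p 0 ⟨1, 0, B⟩)
    (hstep : ∀ t : Fin T, p t (algState B vhat A t) → p (t + 1) (algState B vhat A (t + 1)))
    {k : ℕ} (hk : k ≤ T) : p k (algState B vhat A k) := by
  induction k with
  | zero => exact h0
  | succ k ih => exact hstep ⟨k, hk⟩ (ih (by omega))

lemma lam_pos {k : ℕ} (hk : k ≤ T) : 0 < (algState B vhat A k).lam :=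
  algState_induction B vhat A (p := fun _ S => 0 < S.lam) one_pos
    (fun t ht => by rw [lam_succ]; positivity) hk

lemma mu_nonneg {k : ℕ} (hk : k ≤ T) : 0 ≤ (algState B vhat A k).mu :=
  algState_induction B vhat A (p := fun _ S => 0 ≤ S.mu) le_rfl
    (fun t _ => by rw [mu_succ]; exact le_max_left _ _) hk

lemma budget_nonneg (hB : 0 ≤ B) {k : ℕ} (hk : k ≤ T) : 0 ≤ (algState B vhat A k).budget := by
  refine algState_induction B vhat A (p := fun _ S => 0 ≤ S.budget) hB (fun t ht => ?_) hk
  rw [budget_succ]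
  by_cases h : 1 ≤ (algState B vhat A t).budget
  · linarith [(A t).pay_le_one (algBid B vhat A t)]
  · rw [algBid, DualState.bid_of_budget_lt _ _ (not_le.1 h), (A t).pay_zero]
    linarith

lemma mu_le (hB : 0 ≤ B) {k : ℕ} (hk : k ≤ T) :
    (algState B vhat A k).mu ≤ k / √(T : ℝ) := by
  refine algState_induction B vhat A (p := fun k S => S.mu ≤ (k : ℝ) / √(T : ℝ)) (by simp)
    (fun t ht => ?_) hk
  have hT : 0 < √(T : ℝ) := Real.sqrt_pos.2 (by exact_mod_cast t.pos)
  rw [mu_succ]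
  push_cast
  refine max_le (by positivity) ?_
  have hη : 0 ≤ 1 / ((1 + (B / T) ^ 2) * √(T : ℝ)) := by positivity
  have hη' : 1 / ((1 + (B / T) ^ 2) * √(T : ℝ)) ≤ 1 / √(T : ℝ) := by
    apply one_div_le_one_div_of_le hT
    nlinarith [sq_nonneg (B / T)]
  have h1 : -(B / T - (A t).pay (algBid B vhat A t)) ≤ 1 := by
    have : 0 ≤ B / T := by positivity
    linarith [(A t).pay_le_one (algBid B vhat A t)]
  have h2 := mul_le_mul_of_nonneg_left h1 hη
  rw [add_div]
  linarith

/-- The state before round `k` is determined by the earlier rounds. -/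
lemma algState_congr {vhat' : Fin T → ℝ} {A' : Fin T → TruthfulAuction} {k : ℕ}
    (h : ∀ t : Fin T, (t : ℕ) < k → vhat t = vhat' t ∧ A t = A' t) :
    algState B vhat A k = algState B vhat' A' k := by
  induction k with
  | zero => rfl
  | succ k ih =>
    have ih := ih fun t ht => h t (by omega)
    simp only [algState]
    split_ifs with hk
    · obtain ⟨h1, h2⟩ := h ⟨k, hk⟩ (by simp)
      rw [ih, h1, h2]
    · exact ih

/-- A telescoping sum over the rounds, stopped before round `τ`. -/
lemma sum_ite_lt_sub (f : ℕ → ℝ) {τ : ℕ} (hτ : τ ≤ T) :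
    ∑ t : Fin T, (if (t : ℕ) < τ then f t - f (t + 1) else 0) = f 0 - f τ := by
  rw [Fin.sum_univ_eq_sum_range (fun i => if i < τ then f i - f (i + 1) else 0) T,
    ← Finset.sum_filter]
  have : (Finset.range T).filter (· < τ) = Finset.range τ := by
    ext i; simp only [Finset.mem_filter, Finset.mem_range]; omega
  rw [this]
  exact Finset.sum_range_sub' f τ

lemma sum_ite_lt_succ (f : Fin T → ℝ) (t : Fin T) :
    ∑ i : Fin T, (if (i : ℕ) < t + 1 then f i else 0) =
      ∑ i : Fin T, (if (i : ℕ) < t then f i else 0) + f t := by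
  have : ∀ i : Fin T, (if (i : ℕ) < t + 1 then f i else 0) =
      (if (i : ℕ) < t then f i else 0) + if i = t then f i else 0 := fun i => by
    rcases lt_trichotomy (i : ℕ) t with h | h | h
    · simp [h, h.trans (Nat.lt_succ_self t), Fin.ext_iff, h.ne]
    · simp [h, Fin.ext_iff]
    · simp [not_lt.2 h.le, Fin.ext_iff, h.ne', show ¬ (i : ℕ) < t + 1 by omega]
  rw [Finset.sum_congr rfl fun i _ => this i, Finset.sum_add_distrib]
  simp

lemma sum_sub_eq (f : ℕ → ℝ) : ∑ t : Fin T, (f t - f (t + 1)) = f 0 - f T := by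
  rw [← sum_ite_lt_sub f le_rfl]
  simp

lemma sum_pay_le (hB : 0 ≤ B) : ∑ t, (A t).pay (algBid B vhat A t) ≤ B := by
  have h : ∀ t : Fin T, (A t).pay (algBid B vhat A t) =
      (algState B vhat A t).budget - (algState B vhat A (t + 1)).budget := fun t => by
    rw [budget_succ]; ring
  rw [Finset.sum_congr rfl fun t _ => h t, sum_sub_eq fun k => (algState B vhat A k).budget]
  have := budget_nonneg B vhat A hB (le_refl T)
  change B - _ ≤ B
  linarith

end Run

/-! ### The return-on-spend constraint -/

section RoS
variable {Z : Type*} {T : ℕ}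

lemma Request.value_nonneg (γ : Request Z) : 0 ≤ γ.value := γ.2.1.2.1
lemma Request.value_le_one (γ : Request Z) : γ.value ≤ 1 := γ.2.1.2.2

lemma xi_nonneg (vhat : Fin T → ℝ) (γ : Fin T → Request Z) : 0 ≤ xi vhat γ :=
  div_nonneg (Real.iSup_nonneg fun _ => abs_nonneg _) (Real.iInf_nonneg fun t => (γ t).value_nonneg)

lemma vhat_le_one_add_xi_mul {vhat : Fin T → ℝ} {γ : Fin T → Request Z}
    (hγ : ∀ t, 0 < (γ t).value) (t : Fin T) :
    vhat t ≤ (1 + xi vhat γ) * (γ t).value := by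
  have : Nonempty (Fin T) := ⟨t⟩
  have hinf : 0 < ⨅ t, (γ t).value := by
    obtain ⟨i, hi⟩ := exists_eq_ciInf_of_finite (f := fun t => (γ t).value)
    rw [← hi]; exact hγ i
  have h1 : vhat t - (γ t).value ≤ ⨆ t, |vhat t - (γ t).value| :=
    (le_abs_self _).trans (le_ciSup (f := fun t => |vhat t - (γ t).value|)
      (Set.finite_range _).bddAbove t)
  have h2 : ⨅ t, (γ t).value ≤ (γ t).value := ciInf_le (Set.finite_range _).bddBelow t
  have h3 : (⨆ t, |vhat t - (γ t).value|) = xi vhat γ * ⨅ t, (γ t).value := by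
    rw [xi, div_mul_cancel₀ _ hinf.ne']
  have h4 := mul_le_mul_of_nonneg_left h2 (xi_nonneg vhat γ)
  linarith

/-- While `λ ≤ √T`, the multiplicative update bounds the accumulated violation by
`√T log λ`. Once `λ > √T`, a round adds at most `2 / √T` to the violation. -/
lemma sum_violation_le {B : ℝ} {vhat : Fin T → ℝ} {γ : Fin T → Request Z} (hT : 1 ≤ T)
    (hv : ∀ t, vhat t ≤ 2) (hγ : ∀ t, 0 < (γ t).value) :
    payment (algBids B vhat γ) γ - (1 + xi vhat γ) * reward (algBids B vhat γ) γ ≤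
      1 / 2 * (√(T : ℝ) * Real.log T) + 1 + 2 * √(T : ℝ) := by
  set A : Fin T → TruthfulAuction := fun t => (γ t).auction with hA
  set S := algState B vhat A with hS
  set y : Fin T → ℝ := fun t => (A t).pay (algBid B vhat A t) -
    (1 + xi vhat γ) * ((γ t).value * (A t).alloc (algBid B vhat A t)) with hy
  have hT0 : (0 : ℝ) < T := by exact_mod_cast hT
  have hs : 0 < √(T : ℝ) := Real.sqrt_pos.2 hT0
  have hsum : payment (algBids B vhat γ) γ - (1 + xi vhat γ) * reward (algBids B vhat γ) γ =
      ∑ t, y t := by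
    rw [payment, reward, Finset.mul_sum, ← Finset.sum_sub_distrib]; rfl
  have hxi := xi_nonneg vhat γ
  have hlogT : Real.log √(T : ℝ) = 1 / 2 * Real.log T := by
    rw [Real.log_sqrt hT0.le]; ring
  have hyslack : ∀ t, y t ≤ -slack B vhat A t := fun t => by
    have := mul_le_mul_of_nonneg_right (vhat_le_one_add_xi_mul (vhat := vhat) hγ t)
      ((A t).alloc_nonneg (algBid B vhat A t))
    simp only [hy, slack]
    linarith
  have hylog : ∀ t : Fin T, y t ≤ √(T : ℝ) * Real.log (S (t + 1)).lam -
      √(T : ℝ) * Real.log (S t).lam := fun t => by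
    rw [hS, lam_succ, Real.log_mul (lam_pos B vhat A t.2.le).ne' (Real.exp_ne_zero _), Real.log_exp]
    refine (hyslack t).trans (le_of_eq ?_)
    field_simp
    ring
  have hy1 : ∀ t, y t ≤ 1 := fun t => by
    have h1 : 0 ≤ (1 + xi vhat γ) * ((γ t).value * (A t).alloc (algBid B vhat A t)) :=
      mul_nonneg (by linarith) (mul_nonneg (hγ t).le ((A t).alloc_nonneg _))
    simp only [hy]
    linarith [(A t).pay_le_one (algBid B vhat A t)]
  have hylarge : ∀ t : Fin T, √(T : ℝ) < (S t).lam → y t ≤ 2 / √(T : ℝ) := fun t ht => by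
    rcases le_or_gt 0 (vhat t) with h0 | h0
    · have h1 := (S t).lam_mul_loss_le (A t) (lam_pos B vhat A t.2.le) (mu_nonneg B vhat A t.2.le) h0
      have h2 : vhat t * (A t).alloc ((S t).bid (vhat t)) ≤ 2 * 1 :=
        mul_le_mul (hv t) ((A t).alloc_le_one _) ((A t).alloc_nonneg _) (by norm_num)
      rw [le_div_iff₀ hs]
      have h3 := hyslack t
      simp only [slack, algBid] at h3
      rw [← hS] at h3
      rcases le_or_gt (y t) 0 with h4 | h4
      · exact (mul_nonpos_of_nonpos_of_nonneg h4 hs.le).trans (by norm_num)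
      · have h5 : y t * √(T : ℝ) ≤ y t * (S t).lam := mul_le_mul_of_nonneg_left ht.le h4.le
        have h6 := mul_le_mul_of_nonneg_left h3 (lam_pos B vhat A t.2.le).le
        linarith
    · have hb : algBid B vhat A t = 0 :=
        (S t).bid_of_nonpos (lam_pos B vhat A t.2.le) (mu_nonneg B vhat A t.2.le) h0.le
      have h1 : 0 ≤ (1 + xi vhat γ) * ((γ t).value * (A t).alloc (algBid B vhat A t)) :=
        mul_nonneg (by linarith) (mul_nonneg (hγ t).le ((A t).alloc_nonneg _))
      have h2 : (A t).pay (algBid B vhat A t) = 0 := by rw [hb, (A t).pay_zero]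
      have : 0 ≤ 2 / √(T : ℝ) := by positivity
      simp only [hy]
      linarith
  -- The first bound, by the potential `√T log λ`, serves in the induction: in a round with
  -- `λ ≤ √T` it restarts the second bound, which then grows by `2 / √T` a round while `λ > √T`.
  have key : ∀ k ≤ T, ∑ t : Fin T, (if (t : ℕ) < k then y t else 0) ≤
        √(T : ℝ) * Real.log (S k).lam ∧
      (∑ t : Fin T, (if (t : ℕ) < k then y t else 0) ≤
        1 / 2 * (√(T : ℝ) * Real.log T) + 1 + k * (2 / √(T : ℝ))) := by
    intro k
    induction k with
    | zero =>
      intro _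
      have : (S 0).lam = 1 := rfl
      have h2 : 0 ≤ Real.log T := Real.log_nonneg (by exact_mod_cast hT)
      simp only [not_lt_zero, if_false, Finset.sum_const_zero, this, Real.log_one, mul_zero, le_refl,
        true_and]
      positivity
    | succ k ih =>
      intro hk
      obtain ⟨ih1, ih2⟩ := ih (by omega)
      rw [sum_ite_lt_succ y ⟨k, hk⟩]
      refine ⟨by have := hylog ⟨k, hk⟩; simp only at this; linarith, ?_⟩
      have h2s : 0 ≤ 2 / √(T : ℝ) := by positivity
      push_cast
      rcases le_or_gt (S k).lam √(T : ℝ) with h | h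
      · have h1 : √(T : ℝ) * Real.log (S k).lam ≤ √(T : ℝ) * (1 / 2 * Real.log T) := by
          rw [← hlogT]
          exact mul_le_mul_of_nonneg_left
            (Real.log_le_log (lam_pos B vhat A (by omega)) h) hs.le
        have h2 := hy1 ⟨k, hk⟩
        have h3 : 0 ≤ ((k : ℝ) + 1) * (2 / √(T : ℝ)) := by positivity
        linarith
      · have h1 := hylarge ⟨k, hk⟩ h
        linarith
  have h := (key T le_rfl).2
  simp only [Fin.is_lt, if_true] at h
  rw [hsum]
  refine h.trans (le_of_eq ?_)
  have : (T : ℝ) * (2 / √(T : ℝ)) = 2 * √(T : ℝ) := by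
    have := Real.mul_self_sqrt hT0.le
    field_simp
    nlinarith
  rw [this]

end RoS

/-! ### The dual of the hindsight problem -/

section Dual
variable {Z : Type*} {T : ℕ}

/-- The largest value `max_b (1 + λ) v x(b) - (λ + μ) p(b)` of the Lagrangian of a round with the
true value `v`, written as its value at the maximizer. -/
noncomputable def dualValue (lam mu : ℝ) (γ : Request Z) : ℝ :=
  (1 + lam) * γ.value * γ.auction.alloc (Real.toNNReal ((1 + lam) / (mu + lam) * γ.value)) -
    (lam + mu) * γ.auction.pay (Real.toNNReal ((1 + lam) / (mu + lam) * γ.value))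

lemma lagrangian_le_dualValue {lam mu : ℝ} (hlam : 0 < lam) (hmu : 0 ≤ mu) (γ : Request Z)
    (b : ℝ≥0) : (1 + lam) * γ.value * γ.auction.alloc b - (lam + mu) * γ.auction.pay b ≤
      dualValue lam mu γ :=
  γ.auction.lagrangian_le hlam hmu γ.value_nonneg b

lemma dualValue_nonneg {lam mu : ℝ} (hlam : 0 < lam) (hmu : 0 ≤ mu) (γ : Request Z) :
    0 ≤ dualValue lam mu γ := by
  refine le_trans ?_ (lagrangian_le_dualValue hlam hmu γ 0)
  rw [γ.auction.pay_zero]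
  have := mul_nonneg γ.value_nonneg (γ.auction.alloc_nonneg 0)
  nlinarith

lemma dualValue_le {lam mu : ℝ} (hlam : 0 < lam) (hmu : 0 ≤ mu) (γ : Request Z) :
    dualValue lam mu γ ≤ 1 + lam := by
  rw [dualValue]
  set b := Real.toNNReal ((1 + lam) / (mu + lam) * γ.value)
  have h1 : γ.value * γ.auction.alloc b ≤ 1 :=
    mul_le_one₀ γ.value_le_one (γ.auction.alloc_nonneg b) (γ.auction.alloc_le_one b)
  have h2 := mul_nonneg (by linarith : 0 ≤ lam + mu) (γ.auction.pay_nonneg b)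
  nlinarith

/-- Weak duality. -/
lemma optReward_le_dual {B lam mu : ℝ} (hB : 0 ≤ B) (hlam : 0 < lam) (hmu : 0 ≤ mu)
    (γ : Fin T → Request Z) :
    optReward B γ ≤ ∑ t, dualValue lam mu (γ t) + mu * B := by
  refine Real.sSup_le ?_ (add_nonneg (Finset.sum_nonneg fun t _ => dualValue_nonneg hlam hmu _)
    (mul_nonneg hmu hB))
  rintro _ ⟨b, ⟨hb1, hb2⟩, rfl⟩
  have h : ∑ t, ((1 + lam) * (γ t).value * (γ t).auction.alloc (b t) -
      (lam + mu) * (γ t).auction.pay (b t)) ≤ ∑ t, dualValue lam mu (γ t) :=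
    Finset.sum_le_sum fun t _ => lagrangian_le_dualValue hlam hmu (γ t) (b t)
  have h2 : ∑ t, ((1 + lam) * (γ t).value * (γ t).auction.alloc (b t) -
      (lam + mu) * (γ t).auction.pay (b t)) = (1 + lam) * reward b γ - (lam + mu) * payment b γ := by
    simp only [reward, payment, Finset.mul_sum, ← Finset.sum_sub_distrib, mul_assoc]
  have h3 := mul_le_mul_of_nonneg_left hb1 hmu
  have h4 := mul_le_mul_of_nonneg_left hb2 hlam.le
  simp only
  linarith

lemma reward_nonneg (b : Fin T → ℝ≥0) (γ : Fin T → Request Z) : 0 ≤ reward b γ :=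
  Finset.sum_nonneg fun t _ => mul_nonneg (γ t).value_nonneg ((γ t).auction.alloc_nonneg _)

lemma optReward_le_card (B : ℝ) (γ : Fin T → Request Z) : optReward B γ ≤ T := by
  refine Real.sSup_le ?_ (Nat.cast_nonneg T)
  rintro _ ⟨b, -, rfl⟩
  calc reward b γ ≤ ∑ _t : Fin T, (1 : ℝ) := Finset.sum_le_sum fun t _ =>
        mul_le_one₀ (γ t).value_le_one ((γ t).auction.alloc_nonneg _) ((γ t).auction.alloc_le_one _)
    _ = T := by simp

end Dual

/-! ### Underestimated rounds and active rounds -/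

section Active
variable {Z : Type*} {T : ℕ} (B : ℝ) (vhat : Fin T → ℝ) (γ : Fin T → Request Z)

/-- The indicator of a round whose adjusted value is below the true value. -/
noncomputable def under (t : Fin T) : ℝ := if vhat t < (γ t).value then 1 else 0

/-- The number of underestimated rounds among the first `k`. -/
noncomputable def underCount (k : ℕ) : ℝ := ∑ t : Fin T, if (t : ℕ) < k then under vhat γ t else 0

/-- The state of the algorithm before round `k`. -/
noncomputable def stateAt (k : ℕ) : DualState := algState B vhat (fun t => (γ t).auction) k

/-- Round `k` is active if the budget still allows a bid and at most `√T` rounds before it were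
underestimated. The second condition keeps the multiplier `λ` of order `√T`. -/
def Active (k : ℕ) : Prop :=
  1 ≤ (stateAt B vhat γ k).budget ∧ underCount vhat γ k ≤ √(T : ℝ)

lemma under_nonneg (t : Fin T) : 0 ≤ under vhat γ t := by
  rw [under]; split_ifs <;> norm_num

lemma underCount_succ (t : Fin T) :
    underCount vhat γ (t + 1) = underCount vhat γ t + under vhat γ t :=
  sum_ite_lt_succ _ t

lemma underCount_mono {j k : ℕ} (h : j ≤ k) : underCount vhat γ j ≤ underCount vhat γ k := by
  refine Finset.sum_le_sum fun t _ => ?_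
  by_cases hj : (t : ℕ) < j
  · rw [if_pos hj, if_pos (hj.trans_le h)]
  · rw [if_neg hj]
    split_ifs
    exacts [under_nonneg vhat γ t, le_rfl]

lemma underCount_le (k : ℕ) : underCount vhat γ k ≤ ∑ t, under vhat γ t := by
  refine Finset.sum_le_sum fun t _ => ?_
  split_ifs
  exacts [le_rfl, under_nonneg vhat γ t]

lemma underCount_nonneg (k : ℕ) : 0 ≤ underCount vhat γ k :=
  Finset.sum_nonneg fun t _ => by split_ifs; exacts [under_nonneg vhat γ t, le_rfl]

lemma active_of_succ {t : Fin T} (h : Active B vhat γ (t + 1)) : Active B vhat γ t := by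
  refine ⟨h.1.trans ?_, (underCount_mono vhat γ (Nat.le_succ _)).trans h.2⟩
  rw [stateAt, budget_succ]
  change _ ≤ (algState B vhat _ t).budget
  linarith [(γ t).auction.pay_nonneg (algBid B vhat (fun t => (γ t).auction) t)]

/-- The active rounds are the rounds before some round `τ`. -/
lemma exists_stopping : ∃ τ ≤ T, (∀ t : Fin T, Active B vhat γ t ↔ (t : ℕ) < τ) ∧
    (τ < T → ¬ Active B vhat γ τ) := by
  have hanti : ∀ k j, j + k < T → Active B vhat γ (j + k) → Active B vhat γ j := by
    intro k
    induction k with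
    | zero => exact fun _ _ h => h
    | succ k ih =>
      intro j hj h
      exact ih j (by omega) (active_of_succ B vhat γ (t := ⟨j + k, by omega⟩) h)
  classical
  by_cases h : ∃ k, k < T ∧ ¬ Active B vhat γ k
  · refine ⟨Nat.find h, (Nat.find_spec h).1.le, fun t => ⟨fun ht => ?_, fun ht => ?_⟩,
      fun _ => (Nat.find_spec h).2⟩
    · by_contra! hle
      refine (Nat.find_spec h).2 (hanti (t - Nat.find h) _ ?_ ?_)
      · have := t.2; omega
      · rwa [Nat.add_sub_cancel' hle]
    · by_contra hna
      exact Nat.find_min h ht ⟨t.2, hna⟩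
  · push Not at h
    exact ⟨T, le_rfl, fun t => ⟨fun _ => t.2, fun _ => h t t.2⟩, fun h => absurd h (lt_irrefl T)⟩

variable {B vhat γ}

/-- A round without negative adjusted value increases `λ` by at most `4 / √T`; a round with negative
adjusted value, which is underestimated, multiplies it by at most `exp (1 / √T)`. -/
lemma lam_le (hv : ∀ t, vhat t ∈ Set.Icc (-1 : ℝ) 2) {k : ℕ} (hk : k ≤ T) :
    (stateAt B vhat γ k).lam ≤
      (1 + 4 * (k / √(T : ℝ))) * Real.exp (underCount vhat γ k / √(T : ℝ)) := by
  induction k with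
  | zero =>
    change (1 : ℝ) ≤ _
    simp [underCount]
  | succ k ih =>
    set t : Fin T := ⟨k, hk⟩ with ht
    have ih := ih (by omega)
    have hT : 1 ≤ √(T : ℝ) := Real.one_le_sqrt.2 (by exact_mod_cast t.pos)
    have hT0 : 0 < √(T : ℝ) := by linarith
    have hφ : 1 / √(T : ℝ) ≤ 1 := by rw [div_le_one hT0]; exact hT
    have hsucc : (stateAt B vhat γ (k + 1)).lam = _ := lam_succ B vhat (fun t => (γ t).auction) t
    have hU : underCount vhat γ (k + 1) = _ := underCount_succ vhat γ t
    have hl : 0 < (stateAt B vhat γ k).lam := lam_pos B vhat _ (by omega)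
    have hm : 0 ≤ (stateAt B vhat γ k).mu := mu_nonneg B vhat _ (by omega)
    rw [hsucc, hU]
    change (stateAt B vhat γ k).lam * _ ≤ _
    set S := stateAt B vhat γ k with hS
    set g := slack B vhat (fun t => (γ t).auction) t with hg
    have hgdef : g = vhat t * (γ t).auction.alloc (S.bid (vhat t)) -
      (γ t).auction.pay (S.bid (vhat t)) := rfl
    have hx0 := (γ t).auction.alloc_nonneg (S.bid (vhat t))
    have hx1 := (γ t).auction.alloc_le_one (S.bid (vhat t))
    have hE : (0 : ℝ) < Real.exp (underCount vhat γ k / √(T : ℝ)) := Real.exp_pos _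
    rcases le_or_gt 0 (vhat t) with h0 | h0
    · have hE1 : Real.exp (underCount vhat γ k / √(T : ℝ)) ≤
          Real.exp ((underCount vhat γ t + under vhat γ t) / √(T : ℝ)) := by
        refine Real.exp_le_exp.2 (div_le_div_of_nonneg_right ?_ hT0.le)
        change underCount vhat γ k ≤ underCount vhat γ k + _
        linarith [under_nonneg vhat γ t]
      have hE2 : 1 ≤ Real.exp (underCount vhat γ k / √(T : ℝ)) :=
        Real.one_le_exp (div_nonneg (underCount_nonneg vhat γ k) hT0.le)
      have h1 : S.lam * Real.exp (-(1 / √(T : ℝ)) * g) ≤ S.lam + 4 * (1 / √(T : ℝ)) := by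
        have hφ0 : 0 < 1 / √(T : ℝ) := by positivity
        rcases le_or_gt 0 g with hg0 | hg0
        · have : Real.exp (-(1 / √(T : ℝ)) * g) ≤ 1 :=
            Real.exp_le_one_iff.2 (by nlinarith)
          nlinarith
        · have hloss := S.lam_mul_loss_le (γ t).auction hl hm h0
          have hg1 : -1 ≤ g := by
            rw [hgdef]
            linarith [(γ t).auction.pay_le_one (S.bid (vhat t)), mul_nonneg h0 hx0]
          have hlg : S.lam * (-g) ≤ 2 := by
            rw [hgdef, neg_sub]
            refine hloss.trans ?_
            nlinarith [(hv t).2]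
          have hy0 : 0 ≤ -(1 / √(T : ℝ)) * g := by nlinarith
          have hy1 : -(1 / √(T : ℝ)) * g ≤ 1 := by nlinarith
          have := Real.abs_exp_sub_one_le (x := -(1 / √(T : ℝ)) * g) (by rwa [abs_of_nonneg hy0])
          rw [abs_of_nonneg hy0] at this
          have h2 := le_of_abs_le this
          nlinarith [mul_le_mul_of_nonneg_left hlg hφ0.le]
      push_cast
      calc S.lam * Real.exp (-(1 / √(T : ℝ)) * g) ≤ S.lam + 4 * (1 / √(T : ℝ)) := h1
        _ ≤ (1 + 4 * (k / √(T : ℝ))) * Real.exp (underCount vhat γ k / √(T : ℝ)) +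
            4 * (1 / √(T : ℝ)) * Real.exp (underCount vhat γ k / √(T : ℝ)) :=
          add_le_add ih (le_mul_of_one_le_right (by positivity) hE2)
        _ = (1 + 4 * ((k + 1) / √(T : ℝ))) * Real.exp (underCount vhat γ k / √(T : ℝ)) := by ring
        _ ≤ _ := mul_le_mul_of_nonneg_left hE1 (by positivity)
    · have hu : under vhat γ t = 1 := if_pos (h0.trans_le (γ t).value_nonneg)
      have hb : S.bid (vhat t) = 0 := S.bid_of_nonpos hl hm h0.le
      have hg1 : -1 ≤ g := by
        rw [hgdef, hb, (γ t).auction.pay_zero]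
        rw [hb] at hx0 hx1
        nlinarith [(hv t).1]
      have h1 : -(1 / √(T : ℝ)) * g ≤ 1 / √(T : ℝ) := by
        have : 0 < 1 / √(T : ℝ) := by positivity
        nlinarith
      rw [hu, add_div, Real.exp_add, ← mul_assoc]
      refine mul_le_mul (ih.trans ?_) (Real.exp_le_exp.2 h1) (Real.exp_pos _).le (by positivity)
      refine mul_le_mul_of_nonneg_right ?_ hE.le
      push_cast
      rw [add_div]
      linarith [one_div_pos.2 hT0]

lemma lam_le_of_active (hv : ∀ t, vhat t ∈ Set.Icc (-1 : ℝ) 2) {t : Fin T}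
    (h : Active B vhat γ t) : (stateAt B vhat γ t).lam ≤ 15 * √(T : ℝ) := by
  have hT : 1 ≤ √(T : ℝ) := Real.one_le_sqrt.2 (by exact_mod_cast t.pos)
  have hT0 : 0 < √(T : ℝ) := by linarith
  refine (lam_le hv t.2.le).trans ?_
  have h1 : ((t : ℕ) : ℝ) / √(T : ℝ) ≤ √(T : ℝ) := by
    rw [div_le_iff₀ hT0, Real.mul_self_sqrt (Nat.cast_nonneg T)]
    exact_mod_cast t.2.le
  have h2 : Real.exp (underCount vhat γ t / √(T : ℝ)) ≤ 3 := by
    have : underCount vhat γ t / √(T : ℝ) ≤ 1 := (div_le_one hT0).2 h.2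
    linarith [Real.exp_le_exp.2 this, Real.exp_one_lt_d9]
  calc _ ≤ (5 * √(T : ℝ)) * 3 :=
        mul_le_mul (by linarith) h2 (Real.exp_pos _).le (by positivity)
    _ = _ := by ring

end Active

/-! ### Regret of the two multipliers -/

section MultiplierRegret
variable {Z : Type*} {T : ℕ} {B : ℝ} {vhat : Fin T → ℝ} {γ : Fin T → Request Z}

/-- Online gradient descent against a fixed budget multiplier `m`. -/
lemma sum_mu_regret_le (hT : 1 ≤ T) (hB : 0 ≤ B) {m : ℝ} (hm : 0 ≤ m) {τ : ℕ} (hτ : τ ≤ T) :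
    ∑ t : Fin T, (if (t : ℕ) < τ then ((stateAt B vhat γ t).mu - m) *
      (B / T - (γ t).auction.pay (algBids B vhat γ t)) else 0) ≤
      (m ^ 2 * (1 + (B / T) ^ 2) + 1) / 2 * √(T : ℝ) := by
  have hr : 0 ≤ B / T := div_nonneg hB (Nat.cast_nonneg T)
  set ρ := B / T with hρ
  have hT0 : (0 : ℝ) < T := by exact_mod_cast hT
  have hs : 0 < √(T : ℝ) := Real.sqrt_pos.2 hT0
  have hss := Real.mul_self_sqrt hT0.le
  set s := √(T : ℝ) with hsdef
  set f : ℕ → ℝ := fun k => (1 + ρ ^ 2) * s / 2 * ((stateAt B vhat γ k).mu - m) ^ 2 with hf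
  have hstep : ∀ t : Fin T, ((stateAt B vhat γ t).mu - m) *
      (ρ - (γ t).auction.pay (algBids B vhat γ t)) ≤ f t - f (t + 1) + 1 / (2 * s) := fun t => by
    have hsucc := mu_succ B vhat (fun t => (γ t).auction) t
    set p := (γ t).auction.pay (algBids B vhat γ t) with hp
    have hp0 : 0 ≤ p := (γ t).auction.pay_nonneg _
    have hp1 : p ≤ 1 := (γ t).auction.pay_le_one _
    set u := (stateAt B vhat γ t).mu with hu
    have hsucc : (stateAt B vhat γ (t + 1)).mu = max 0 (u - 1 / ((1 + ρ ^ 2) * s) * (ρ - p)) := hsucc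
    have hc : 0 < (1 + ρ ^ 2) * s := by positivity
    have h1 : ((stateAt B vhat γ (t + 1)).mu - m) ^ 2 ≤
        (u - 1 / ((1 + ρ ^ 2) * s) * (ρ - p) - m) ^ 2 := by
      rw [hsucc]
      rcases le_total 0 (u - 1 / ((1 + ρ ^ 2) * s) * (ρ - p)) with h | h
      · rw [max_eq_right h]
      · rw [max_eq_left h]
        nlinarith
    have h2 : (1 + ρ ^ 2) * s / 2 * (u - 1 / ((1 + ρ ^ 2) * s) * (ρ - p) - m) ^ 2 =
        (1 + ρ ^ 2) * s / 2 * (u - m) ^ 2 - (u - m) * (ρ - p) +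
          (ρ - p) ^ 2 / (2 * ((1 + ρ ^ 2) * s)) := by
      field_simp
      ring
    have h3 : (ρ - p) ^ 2 / (2 * ((1 + ρ ^ 2) * s)) ≤ 1 / (2 * s) := by
      rw [div_le_div_iff₀ (by positivity) (by positivity)]
      have : (ρ - p) ^ 2 ≤ 1 + ρ ^ 2 := by nlinarith [mul_nonneg hr hp0]
      nlinarith
    have h4 := mul_le_mul_of_nonneg_left h1 (by positivity : 0 ≤ (1 + ρ ^ 2) * s / 2)
    simp only [hf]
    linarith
  calc _ ≤ ∑ t : Fin T, ((if (t : ℕ) < τ then f t - f (t + 1) else 0) + 1 / (2 * s)) :=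
        Finset.sum_le_sum fun t _ => by
          split_ifs
          · exact hstep t
          · positivity
    _ = f 0 - f τ + s / 2 := by
        rw [Finset.sum_add_distrib, sum_ite_lt_sub f hτ]
        simp only [Finset.sum_const, Finset.card_univ, Fintype.card_fin, nsmul_eq_mul]
        rw [← hss]
        field_simp
    _ ≤ _ := by
        have h0 : f 0 = (1 + ρ ^ 2) * s / 2 * m ^ 2 := by
          change (1 + ρ ^ 2) * s / 2 * (0 - m) ^ 2 = _
          ring
        have hτ0 : 0 ≤ f τ := by positivity
        rw [h0]
        linarith

/-- Exponential weights against the RoS multiplier `0`. Here `λ` may be of order `√T`, so the second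
order term `λ g² / √T` of a round with slack `g` needs care: for `g ≥ 0` it is at most `2 λ g / √T` and
absorbed on the left; for `g < 0` it is at most `-λ g / √T`, where `-λ g` is at most `2`, or at most
`λ ≤ 15 √T` if the adjusted value is negative and the round thus underestimated. -/
lemma sum_lam_regret_le (hT : 16 ≤ T) (hv : ∀ t, vhat t ∈ Set.Icc (-1 : ℝ) 2) {τ : ℕ} (hτ : τ ≤ T)
    (hlam : ∀ t : Fin T, (t : ℕ) < τ → (stateAt B vhat γ t).lam ≤ 15 * √(T : ℝ)) :
    ∑ t : Fin T, (if (t : ℕ) < τ then (stateAt B vhat γ t).lam *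
      slack B vhat (fun t => (γ t).auction) t else 0) ≤
      14 * √(T : ℝ) + 90 * √(T : ℝ) * ∑ t, under vhat γ t := by
  have hT0 : (0 : ℝ) < T := by exact_mod_cast (by omega : 0 < T)
  have hs4 : 4 ≤ √(T : ℝ) := by
    rw [show (4 : ℝ) = √16 by rw [show (16 : ℝ) = 4 ^ 2 by norm_num]; simp]
    exact Real.sqrt_le_sqrt (by exact_mod_cast hT)
  have hss := Real.mul_self_sqrt hT0.le
  set s := √(T : ℝ) with hsdef
  have hs : 0 < s := by linarith
  set f : ℕ → ℝ := fun k => s * (stateAt B vhat γ k).lam with hf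
  have hstep : ∀ t : Fin T, (t : ℕ) < τ → (1 - 2 / s) * ((stateAt B vhat γ t).lam *
      slack B vhat (fun t => (γ t).auction) t) ≤
        f t - f (t + 1) + 6 / s + 45 * under vhat γ t := fun t ht => by
    have hlt := hlam t ht
    have hsucc : (stateAt B vhat γ (t + 1)).lam = _ := lam_succ B vhat (fun t => (γ t).auction) t
    have hl : 0 < (stateAt B vhat γ t).lam := lam_pos B vhat _ t.2.le
    have hm : 0 ≤ (stateAt B vhat γ t).mu := mu_nonneg B vhat _ t.2.le
    simp only [hf]
    rw [hsucc]
    change _ ≤ _ - s * ((stateAt B vhat γ t).lam * _) + _ + _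
    set S := stateAt B vhat γ t with hS
    set g := slack B vhat (fun t => (γ t).auction) t with hg
    have hgdef : g = vhat t * (γ t).auction.alloc (S.bid (vhat t)) -
      (γ t).auction.pay (S.bid (vhat t)) := rfl
    have hx0 := (γ t).auction.alloc_nonneg (S.bid (vhat t))
    have hx1 := (γ t).auction.alloc_le_one (S.bid (vhat t))
    have hp0 := (γ t).auction.pay_nonneg (S.bid (vhat t))
    have hp1 := (γ t).auction.pay_le_one (S.bid (vhat t))
    have hu := under_nonneg vhat γ t
    have hg2 : g ≤ 2 := by rw [hgdef]; nlinarith [(hv t).2]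
    have hneg : -1 ≤ g ∧ S.lam * (-g) ≤ 2 + 15 * s * under vhat γ t := by
      rcases le_or_gt 0 (vhat t) with h0 | h0
      · have hloss := S.lam_mul_loss_le (γ t).auction hl hm h0
        constructor
        · rw [hgdef]; linarith [mul_nonneg h0 hx0]
        · rw [hgdef, neg_sub]
          nlinarith [(hv t).2, mul_nonneg hs.le hu]
      · have hu : under vhat γ t = 1 := if_pos (h0.trans_le (γ t).value_nonneg)
        have hb : S.bid (vhat t) = 0 := S.bid_of_nonpos hl hm h0.le
        have hg1 : -1 ≤ g := by
          rw [hgdef, hb, (γ t).auction.pay_zero]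
          rw [hb] at hx0 hx1
          nlinarith [(hv t).1]
        refine ⟨hg1, ?_⟩
        rw [hu]
        nlinarith
    obtain ⟨hg1, hlg⟩ := hneg
    set y := 1 / s * g with hy
    -- valid for `|y| ≤ 1`, hence the assumption on `T`
    have hexp : Real.exp (-(1 / s) * g) ≤ 1 - y + y ^ 2 := by
      have hy1 : |-y| ≤ 1 := by
        rw [abs_neg, hy, one_div_mul_eq_div, abs_div, abs_of_pos hs, div_le_one hs]
        exact abs_le.2 ⟨by linarith, by linarith⟩
      have := le_of_abs_le (Real.abs_exp_sub_one_sub_id_le hy1)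
      rw [show -(1 / s) * g = -y by rw [hy]; ring]
      nlinarith
    have hsy : s * y = g := by rw [hy]; field_simp
    have hsyy : s * y ^ 2 = g ^ 2 / s := by rw [hy]; field_simp
    have h1 : s * S.lam - s * (S.lam * Real.exp (-(1 / s) * g)) ≥ S.lam * g - S.lam * (g ^ 2 / s) := by
      rw [← hsyy]
      have h0 : S.lam * g = S.lam * (s * y) := by rw [hsy]
      have := mul_le_mul_of_nonneg_left hexp (mul_pos hs hl).le
      linarith
    have h2 : S.lam * (g ^ 2 / s) ≤ 2 / s * (S.lam * g) + 3 / s * (2 + 15 * s * under vhat γ t) := by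
      have h3 : S.lam * g ^ 2 ≤ 2 * (S.lam * g) + 3 * (2 + 15 * s * under vhat γ t) := by
        rcases le_or_gt 0 g with hg0 | hg0
        · have : 0 ≤ s * under vhat γ t := mul_nonneg hs.le hu
          nlinarith [mul_nonneg (mul_nonneg hl.le hg0) (sub_nonneg.2 hg2)]
        · nlinarith [mul_nonneg (mul_nonneg hl.le (neg_nonneg.2 hg0.le)) (by linarith : 0 ≤ 1 + g)]
      have h4 := div_le_div_of_nonneg_right h3 hs.le
      calc S.lam * (g ^ 2 / s) = S.lam * g ^ 2 / s := by ring
        _ ≤ _ := h4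
        _ = _ := by ring
    have h5 : 3 / s * (2 + 15 * s * under vhat γ t) = 6 / s + 45 * under vhat γ t := by
      field_simp
      ring
    rw [h5] at h2
    linarith
  set L := ∑ t : Fin T, (if (t : ℕ) < τ then (stateAt B vhat γ t).lam *
      slack B vhat (fun t => (γ t).auction) t else 0) with hL
  have hsum : (1 - 2 / s) * L ≤ 7 * s + 45 * ∑ t, under vhat γ t := by
    calc (1 - 2 / s) * L ≤ ∑ t : Fin T, ((if (t : ℕ) < τ then f t - f (t + 1) else 0) +
          (6 / s + 45 * under vhat γ t)) := by
          rw [hL, Finset.mul_sum]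
          refine Finset.sum_le_sum fun t _ => ?_
          split_ifs with h
          · linarith [hstep t h]
          · have := under_nonneg vhat γ t
            rw [mul_zero]
            positivity
      _ = f 0 - f τ + 6 * s + 45 * ∑ t, under vhat γ t := by
          rw [Finset.sum_add_distrib, Finset.sum_add_distrib, sum_ite_lt_sub f hτ, Finset.mul_sum]
          simp only [Finset.sum_const, Finset.card_univ, Fintype.card_fin, nsmul_eq_mul]
          rw [← hss]
          field_simp
          ring
      _ ≤ _ := by
          have h0 : f 0 = s := by
            change s * 1 = _
            ring
          have : 0 ≤ f τ := mul_nonneg hs.le (lam_pos B vhat _ hτ).le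
          linarith
  have hU : 0 ≤ ∑ t, under vhat γ t := Finset.sum_nonneg fun t _ => under_nonneg vhat γ t
  have hhalf : 2 / s ≤ 1 / 2 := by rw [div_le_div_iff₀ hs two_pos]; linarith
  rcases le_or_gt 0 L with h | h
  · nlinarith
  · nlinarith

end MultiplierRegret

/-! ### The regret on a fixed sequence of requests -/

section PathwiseRegret
variable {Z : Type*} {T : ℕ} {B : ℝ} {vhat : Fin T → ℝ} {γ : Fin T → Request Z}

open Classical in
/-- The gap of round `t` between the dual objective at a fixed pair `(λ, μ)` of multipliers and, in
an active round, the dual objective at the multipliers of the algorithm. In an inactive round the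
comparison is with the constant `3`, which exceeds the optimal dual value per round. -/
noncomputable def dualGap (B : ℝ) (vhat : Fin T → ℝ) (lam mu : ℝ) (γ : Fin T → Request Z)
    (t : Fin T) : ℝ :=
  dualValue lam mu (γ t) + mu * (B / T) -
    if Active B vhat γ t then
      dualValue (stateAt B vhat γ t).lam (stateAt B vhat γ t).mu (γ t) +
        (stateAt B vhat γ t).mu * (B / T)
    else 3

/-- The bid of an active round maximizes the Lagrangian with the adjusted value. This is at least
the maximum for the true value, unless the round is underestimated. -/
lemma dualValue_le_of_active (hv : ∀ t, vhat t ∈ Set.Icc (-1 : ℝ) 2) {t : Fin T}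
    (h : Active B vhat γ t) :
    dualValue (stateAt B vhat γ t).lam (stateAt B vhat γ t).mu (γ t) ≤
      vhat t * (γ t).auction.alloc (algBids B vhat γ t) -
        (stateAt B vhat γ t).mu * (γ t).auction.pay (algBids B vhat γ t) +
        (stateAt B vhat γ t).lam * slack B vhat (fun t => (γ t).auction) t +
        32 * √(T : ℝ) * under vhat γ t := by
  have hl : 0 < (stateAt B vhat γ t).lam := lam_pos B vhat _ t.2.le
  have hm : 0 ≤ (stateAt B vhat γ t).mu := mu_nonneg B vhat _ t.2.le
  have hl15 := lam_le_of_active hv h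
  have hs1 : 1 ≤ √(T : ℝ) := Real.one_le_sqrt.2 (by exact_mod_cast t.pos)
  have hfle := dualValue_le hl hm (γ t)
  have hbud : 1 ≤ (stateAt B vhat γ t).budget := h.1
  have hbid : algBids B vhat γ t = (stateAt B vhat γ t).bid (vhat t) := rfl
  have hslack : slack B vhat (fun t => (γ t).auction) t =
    vhat t * (γ t).auction.alloc (algBids B vhat γ t) -
      (γ t).auction.pay (algBids B vhat γ t) := rfl
  rw [hslack]
  set S := stateAt B vhat γ t with hS
  -- the Lagrangian with the adjusted value
  have hrew : vhat t * (γ t).auction.alloc (algBids B vhat γ t) -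
      S.mu * (γ t).auction.pay (algBids B vhat γ t) +
      S.lam * (vhat t * (γ t).auction.alloc (algBids B vhat γ t) -
        (γ t).auction.pay (algBids B vhat γ t)) =
      (1 + S.lam) * vhat t * (γ t).auction.alloc (algBids B vhat γ t) -
        (S.lam + S.mu) * (γ t).auction.pay (algBids B vhat γ t) := by ring
  rw [hrew]
  have hx0 := (γ t).auction.alloc_nonneg
  rcases lt_or_ge (vhat t) (γ t).value with hlt | hge
  · have hu : under vhat γ t = 1 := if_pos hlt
    rw [hu]
    have hlow : -(1 + S.lam) ≤ (1 + S.lam) * vhat t * (γ t).auction.alloc (algBids B vhat γ t) -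
        (S.lam + S.mu) * (γ t).auction.pay (algBids B vhat γ t) := by
      rcases le_or_gt 0 (vhat t) with h0 | h0
      · have h1 := (γ t).auction.lagrangian_le hl hm h0 0
        rw [(γ t).auction.pay_zero, ← S.bid_of_le_budget _ hbud, ← hbid] at h1
        have h2 := mul_nonneg (mul_nonneg (by linarith : 0 ≤ 1 + S.lam) h0) (hx0 0)
        linarith
      · rw [hbid, S.bid_of_nonpos hl hm h0.le, (γ t).auction.pay_zero]
        have h1 : -1 ≤ vhat t * (γ t).auction.alloc 0 := by
          nlinarith [hx0 0, (γ t).auction.alloc_le_one 0, (hv t).1]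
        nlinarith
    linarith
  · have hu : under vhat γ t = 0 := if_neg (not_lt.2 hge)
    rw [hu, mul_zero, add_zero]
    have h0 : 0 ≤ vhat t := (γ t).value_nonneg.trans hge
    have h1 := (γ t).auction.lagrangian_le hl hm h0
      (Real.toNNReal ((1 + S.lam) / (S.mu + S.lam) * (γ t).value))
    rw [← S.bid_of_le_budget (vhat t) hbud, ← hbid] at h1
    refine le_trans ?_ h1
    have h2 := mul_le_mul_of_nonneg_left (mul_le_mul_of_nonneg_right hge (hx0
      (Real.toNNReal ((1 + S.lam) / (S.mu + S.lam) * (γ t).value)))) (by linarith : 0 ≤ 1 + S.lam)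
    rw [dualValue]
    linarith

/-- If the active rounds end early because the budget is exhausted, the multiplier `3 / (B / T)` pays
for the remaining rounds. If they end early because more than `√T` rounds are underestimated, these
rounds do. -/
lemma sum_mu_add_inactive_le (hT : 1 ≤ T) {c : ℝ} (hc : 0 < c) (hcB : c ≤ B / T) {τ : ℕ}
    (hτ : τ ≤ T) (hend : τ < T → ¬ Active B vhat γ τ) :
    ∑ t : Fin T, (if (t : ℕ) < τ then (stateAt B vhat γ t).mu *
        (B / T - (γ t).auction.pay (algBids B vhat γ t)) else 3) ≤
      (3 / c + 5 / c ^ 2 + 5) * √(T : ℝ) + 3 * √(T : ℝ) * ∑ t, under vhat γ t := by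
  have hT0 : (0 : ℝ) < T := by exact_mod_cast hT
  have hρ0 : 0 < B / T := hc.trans_le hcB
  have hB : 0 < B := by
    have := mul_pos hρ0 hT0
    rwa [div_mul_cancel₀ _ hT0.ne'] at this
  have hs1 : 1 ≤ √(T : ℝ) := Real.one_le_sqrt.2 (by exact_mod_cast hT)
  have hss := Real.mul_self_sqrt hT0.le
  have hreg := fun m hm => sum_mu_regret_le (vhat := vhat) (γ := γ) hT hB.le (m := m) hm hτ
  have hBρ : B = B / T * T := by field_simp
  set ρ := B / T with hρ
  set s := √(T : ℝ) with hsdef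
  set N := ∑ t, under vhat γ t with hN
  have hN0 : 0 ≤ N := Finset.sum_nonneg fun t _ => under_nonneg vhat γ t
  have hsN : 0 ≤ s * N := mul_nonneg (by linarith) hN0
  have hpay : ∑ t : Fin T, (if (t : ℕ) < τ then ρ - (γ t).auction.pay (algBids B vhat γ t) else 0) =
      -B + ρ * τ + (stateAt B vhat γ τ).budget := by
    set h : ℕ → ℝ := fun k => -(ρ * k) - (stateAt B vhat γ k).budget with hh
    have h1 : ∀ t : Fin T, ρ - (γ t).auction.pay (algBids B vhat γ t) = h t - h (t + 1) := fun t => by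
      have hsucc : (stateAt B vhat γ (t + 1)).budget = (stateAt B vhat γ t).budget -
        (γ t).auction.pay (algBids B vhat γ t) := budget_succ B vhat (fun t => (γ t).auction) t
      simp only [hh]
      rw [hsucc]
      push_cast
      ring
    simp only [h1]
    rw [sum_ite_lt_sub h hτ]
    simp only [hh]
    have : (stateAt B vhat γ 0).budget = B := rfl
    rw [this]
    push_cast
    ring
  have hrest : ∑ t : Fin T, (if (t : ℕ) < τ then (0 : ℝ) else 3) = 3 * T - 3 * τ := by
    have h1 : ∀ t : Fin T, (if (t : ℕ) < τ then (0 : ℝ) else 3) =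
        3 - if (t : ℕ) < τ then (-(3 * ((t : ℕ) : ℝ))) - (-(3 * ((t + 1 : ℕ) : ℝ))) else 0 :=
      fun t => by
        split_ifs
        · push_cast; ring
        · ring
    rw [Finset.sum_congr rfl fun t _ => h1 t, Finset.sum_sub_distrib,
      sum_ite_lt_sub (fun k => -(3 * (k : ℝ))) hτ]
    simp
    ring
  have hsplit : ∀ m : ℝ, ∑ t : Fin T, (if (t : ℕ) < τ then (stateAt B vhat γ t).mu *
        (ρ - (γ t).auction.pay (algBids B vhat γ t)) else 3) =
      ∑ t : Fin T, (if (t : ℕ) < τ then ((stateAt B vhat γ t).mu - m) *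
        (ρ - (γ t).auction.pay (algBids B vhat γ t)) else 0) +
      m * (-B + ρ * τ + (stateAt B vhat γ τ).budget) + (3 * T - 3 * τ) := fun m => by
    rw [← hpay, ← hrest, Finset.mul_sum, ← Finset.sum_add_distrib, ← Finset.sum_add_distrib]
    refine Finset.sum_congr rfl fun t _ => ?_
    split_ifs <;> ring
  have hc1 : 0 ≤ 3 / c := by positivity
  have hc2 : 0 ≤ 5 / c ^ 2 := by positivity
  have hcs : 0 ≤ (3 / c + 5 / c ^ 2) * s := by positivity
  by_cases hτT : 3 * (T : ℝ) - 3 * τ ≤ 3 * s * N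
  · rw [hsplit 0]
    have := hreg 0 le_rfl
    linarith
  · have hlt : τ < T := by
      by_contra hle
      have : τ = T := le_antisymm hτ (not_lt.1 hle)
      rw [this] at hτT
      exact hτT (by linarith)
    have hbud : (stateAt B vhat γ τ).budget < 1 := by
      by_contra hge
      refine hτT ?_
      have hNs : s < N := by
        by_contra hle
        exact hend hlt ⟨not_lt.1 hge, (underCount_le vhat γ τ).trans (not_lt.1 hle)⟩
      have h1 : s * s ≤ s * N := mul_le_mul_of_nonneg_left hNs.le (by linarith)
      have : (0 : ℝ) ≤ τ := Nat.cast_nonneg τ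
      linarith
    rw [hsplit (3 / ρ)]
    have h1 := hreg (3 / ρ) (by positivity)
    have h2 : 3 / ρ * (-B + ρ * τ + (stateAt B vhat γ τ).budget) ≤ 3 / ρ * (-(ρ * T) + ρ * τ + 1) :=
      mul_le_mul_of_nonneg_left (by linarith) (by positivity)
    have h3 : 3 / ρ * (-(ρ * T) + ρ * τ + 1) = -(3 * T) + 3 * τ + 3 / ρ := by field_simp
    have h4 : 3 / ρ ≤ 3 / c := div_le_div_of_nonneg_left (by norm_num) hc hcB
    have h5 : (3 / ρ) ^ 2 * (1 + ρ ^ 2) = 9 / ρ ^ 2 + 9 := by field_simp; ring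
    have h6 : 9 / ρ ^ 2 ≤ 9 / c ^ 2 :=
      div_le_div_of_nonneg_left (by norm_num) (by positivity) (pow_le_pow_left₀ hc.le hcB 2)
    have h7 : 9 / c ^ 2 ≤ 2 * (5 / c ^ 2) := by
      rw [mul_div_assoc', div_le_div_iff_of_pos_right (by positivity)]
      norm_num
    rw [h5] at h1
    have h8 : (9 / ρ ^ 2 + 9 + 1) / 2 * s ≤ (5 / c ^ 2 + 5) * s :=
      mul_le_mul_of_nonneg_right (by linarith) (by linarith)
    have h9 : 3 / c ≤ 3 / c * s := le_mul_of_one_le_right hc1 hs1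
    linarith

/-- On every sequence of requests, the regret is at most the sum of the dual gaps, up to order
`√T` and order `√T` for each underestimated round. -/
lemma regret_le_sum_dualGap (hT : 16 ≤ T) {c : ℝ} (hc : 0 < c) (hcB : c ≤ B / T)
    (hv : ∀ t, vhat t ∈ Set.Icc (-1 : ℝ) 2) (hγ : ∀ t, 0 < (γ t).value) {lam mu : ℝ}
    (hlam : 0 < lam) (hmu : 0 ≤ mu) :
    1 / (1 + xi vhat γ) * optReward B γ - reward (algBids B vhat γ) γ ≤
      1 / (1 + xi vhat γ) * ∑ t, dualGap B vhat lam mu γ t +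
        (3 / c + 5 / c ^ 2 + 125) * √(T : ℝ) * (1 + ∑ t, under vhat γ t) := by
  have hT0 : (0 : ℝ) < T := by exact_mod_cast (by omega : 0 < T)
  have hρ0 : 0 < B / T := hc.trans_le hcB
  have hB : 0 < B := by
    have := mul_pos hρ0 hT0
    rwa [div_mul_cancel₀ _ hT0.ne'] at this
  have hxi := xi_nonneg vhat γ
  have hs1 : 1 ≤ √(T : ℝ) := Real.one_le_sqrt.2 (by exact_mod_cast (by omega : 1 ≤ T))
  obtain ⟨τ, hτ, hact, hend⟩ := exists_stopping B vhat γ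
  have hmureg := sum_mu_add_inactive_le (by omega) hc hcB hτ hend
  have hlamreg := sum_lam_regret_le hT hv hτ fun t ht => lam_le_of_active hv ((hact t).2 ht)
  set W := 1 / (1 + xi vhat γ) with hW
  have hW0 : 0 ≤ W := by positivity
  have hW1 : W ≤ 1 := by rw [hW, div_le_one (by linarith)]; linarith
  set N := ∑ t, under vhat γ t with hN
  have hN0 : 0 ≤ N := Finset.sum_nonneg fun t _ => under_nonneg vhat γ t
  have hsN : 0 ≤ √(T : ℝ) * N := mul_nonneg (by linarith) hN0
  have hrew : W * ∑ t : Fin T, (if (t : ℕ) < τ then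
      vhat t * (γ t).auction.alloc (algBids B vhat γ t) else 0) ≤ reward (algBids B vhat γ) γ := by
    rw [Finset.mul_sum, reward]
    refine Finset.sum_le_sum fun t _ => ?_
    have hx0 := (γ t).auction.alloc_nonneg (algBids B vhat γ t)
    split_ifs
    · have h1 := mul_le_mul_of_nonneg_left (mul_le_mul_of_nonneg_right
        (vhat_le_one_add_xi_mul (vhat := vhat) hγ t) hx0) hW0
      have h2 : W * ((1 + xi vhat γ) * (γ t).value * (γ t).auction.alloc (algBids B vhat γ t)) =
          (γ t).value * (γ t).auction.alloc (algBids B vhat γ t) := by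
        rw [hW]; field_simp
      rwa [h2] at h1
    · rw [mul_zero]
      exact mul_nonneg (γ t).value_nonneg hx0
  have hopt := optReward_le_dual hB.le hlam hmu γ
  have hround : ∀ t : Fin T, dualValue lam mu (γ t) + mu * (B / T) -
      (if (t : ℕ) < τ then vhat t * (γ t).auction.alloc (algBids B vhat γ t) else 0) ≤
      dualGap B vhat lam mu γ t +
      (if (t : ℕ) < τ then (stateAt B vhat γ t).mu *
        (B / T - (γ t).auction.pay (algBids B vhat γ t)) else 3) +
      (if (t : ℕ) < τ then (stateAt B vhat γ t).lam *
        slack B vhat (fun t => (γ t).auction) t else 0) +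
      32 * √(T : ℝ) * under vhat γ t := fun t => by
    rw [dualGap]
    by_cases ht : (t : ℕ) < τ
    · have h := (hact t).2 ht
      rw [if_pos ht, if_pos ht, if_pos ht, if_pos h]
      linarith [dualValue_le_of_active hv h]
    · have h := fun h => ht ((hact t).1 h)
      rw [if_neg ht, if_neg ht, if_neg ht, if_neg h]
      have : 0 ≤ 32 * √(T : ℝ) * under vhat γ t :=
        mul_nonneg (by positivity) (under_nonneg vhat γ t)
      linarith
  have hsum := Finset.sum_le_sum fun t (_ : t ∈ Finset.univ) => hround t
  simp only [Finset.sum_sub_distrib, Finset.sum_add_distrib, ← Finset.mul_sum, Finset.sum_const,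
    Finset.card_univ, Fintype.card_fin, nsmul_eq_mul] at hsum
  have hTB : mu * (T * (B / T)) = mu * B := by field_simp
  rw [hTB] at hsum
  set R := (3 / c + 5 / c ^ 2 + 125) * √(T : ℝ) * (1 + N) with hR
  have hc1 : 0 ≤ 3 / c * (√(T : ℝ) * N) := by positivity
  have hc2 : 0 ≤ 5 / c ^ 2 * (√(T : ℝ) * N) := by positivity
  have hR0 : 0 ≤ R := by positivity
  have hdiff : optReward B γ - ∑ t : Fin T, (if (t : ℕ) < τ then
      vhat t * (γ t).auction.alloc (algBids B vhat γ t) else 0) ≤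
      ∑ t, dualGap B vhat lam mu γ t + R := by
    have : (3 / c + 5 / c ^ 2 + 5) * √(T : ℝ) + 3 * √(T : ℝ) * N +
        (14 * √(T : ℝ) + 90 * √(T : ℝ) * N) + 32 * √(T : ℝ) * N ≤ R := by
      rw [hR]
      linarith
    linarith
  have h1 := mul_le_mul_of_nonneg_left hdiff hW0
  have h2 : W * R ≤ R := mul_le_of_le_one_left hR0 hW1
  linarith

end PathwiseRegret

/-! ### Total variation -/

section TotalVariation
variable {Ω : Type*} [MeasurableSpace Ω] {μ ν : Measure Ω} [IsProbabilityMeasure μ]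
  [IsProbabilityMeasure ν]

lemma abs_measureReal_sub_le_tvDist {A : Set Ω} (hA : MeasurableSet A) :
    |μ.real A - ν.real A| ≤ tvDist μ ν := by
  refine le_ciSup (f := fun A : {A : Set Ω // MeasurableSet A} => |μ.real A.1 - ν.real A.1|)
    ⟨1, ?_⟩ ⟨A, hA⟩
  rintro _ ⟨A, rfl⟩
  have h1 : μ.real A.1 ≤ 1 := measureReal_le_one
  have h2 : ν.real A.1 ≤ 1 := measureReal_le_one
  exact abs_le.2 ⟨by linarith [measureReal_nonneg (μ := μ) (s := A.1)],
    by linarith [measureReal_nonneg (μ := ν) (s := A.1)]⟩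

omit [IsProbabilityMeasure μ] [IsProbabilityMeasure ν] in
lemma tvDist_nonneg : 0 ≤ tvDist μ ν := Real.iSup_nonneg fun _ => abs_nonneg _

omit [IsProbabilityMeasure ν] in
lemma integrable_of_mem_Icc {f : Ω → ℝ} (hf : Measurable f) {a b : ℝ}
    (h : ∀ x, f x ∈ Set.Icc a b) : Integrable f μ :=
  Integrable.of_mem_Icc a b hf.aemeasurable (Filter.Eventually.of_forall h)

/-- By the layer-cake formula, the integrals of a function with values in `[0, R]` differ by at most
`R` times the total variation distance. -/
lemma integral_le_integral_add_tvDist {f : Ω → ℝ} (hf : Measurable f) {R : ℝ}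
    (h : ∀ x, f x ∈ Set.Icc 0 R) : ∫ x, f x ∂μ ≤ ∫ x, f x ∂ν + R * tvDist μ ν := by
  obtain ⟨x₀⟩ : Nonempty Ω := μ.nonempty_of_neZero
  have hR : 0 ≤ R := (h x₀).1.trans (h x₀).2
  have hlayer : ∀ m : Measure Ω, IsProbabilityMeasure m →
      ∫ x, f x ∂m = ∫ s in Set.Ioc 0 R, m.real {x | s ≤ f x} ∧
      IntegrableOn (fun s => m.real {x | s ≤ f x}) (Set.Ioc 0 R) := fun m _ => by
    refine ⟨(integrable_of_mem_Icc hf h).integral_eq_integral_Ioc_meas_le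
      (Filter.Eventually.of_forall fun x => (h x).1)
      (Filter.Eventually.of_forall fun x => (h x).2), ?_⟩
    have hanti : Antitone fun s => m.real {x | s ≤ f x} := fun s s' hs =>
      measureReal_mono fun x hx => le_trans hs hx
    exact Integrable.of_mem_Icc 0 1 hanti.measurable.aemeasurable
      (Filter.Eventually.of_forall fun s => ⟨measureReal_nonneg, measureReal_le_one⟩)
  obtain ⟨h1, h1'⟩ := hlayer μ inferInstance
  obtain ⟨h2, h2'⟩ := hlayer ν inferInstance
  have h3 : ∫ _s in Set.Ioc 0 R, tvDist μ ν = R * tvDist μ ν := by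
    rw [setIntegral_const, Measure.real, Real.volume_Ioc, sub_zero, ENNReal.toReal_ofReal hR,
      smul_eq_mul]
  have h4 : IntegrableOn (fun _ : ℝ => tvDist μ ν) (Set.Ioc 0 R) := integrable_const _
  rw [h1, h2, ← h3, ← integral_add h2' h4]
  refine integral_mono h1' (h2'.add h4) fun s => ?_
  have := le_of_abs_le (abs_measureReal_sub_le_tvDist (μ := μ) (ν := ν)
    (measurableSet_le (measurable_const (a := s)) hf))
  simp only
  linarith

end TotalVariation

/-! ### Resampling a coordinate of a product measure -/

section Resample
variable {Ω : Type*} [MeasurableSpace Ω] {T : ℕ} (P : Fin T → Measure Ω)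
  [∀ t, IsProbabilityMeasure (P t)]

lemma measurePreserving_update (t : Fin T) :
    MeasurePreserving (fun q : (Fin T → Ω) × Ω => Function.update q.1 t q.2)
      ((Measure.pi P).prod (P t)) (Measure.pi P) := by
  have hmeas : Measurable fun q : (Fin T → Ω) × Ω => Function.update q.1 t q.2 := by
    refine measurable_pi_lambda _ fun i => ?_
    by_cases hi : i = t
    · subst hi; simpa using measurable_snd
    · simp only [Function.update_of_ne hi]
      exact (measurable_pi_apply i).comp measurable_fst
  refine ⟨hmeas, (Measure.pi_eq fun s hs => ?_).symm⟩
  rw [Measure.map_apply hmeas (MeasurableSet.univ_pi hs)]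
  have : (fun q : (Fin T → Ω) × Ω => Function.update q.1 t q.2) ⁻¹' Set.univ.pi s =
      (Set.univ.pi (Function.update s t Set.univ)) ×ˢ s t := by
    ext ⟨γ, x⟩
    simp only [Set.mem_preimage, Set.mem_univ_pi, Set.mem_prod]
    constructor
    · refine fun h => ⟨fun i => ?_, by simpa using h t⟩
      by_cases hi : i = t
      · subst hi; simp
      · simpa [hi] using h i
    · rintro ⟨h1, h2⟩ i
      by_cases hi : i = t
      · subst hi; simpa using h2
      · simpa [hi] using h1 i
  rw [this, Measure.prod_prod, Measure.pi_pi, ← Finset.mul_prod_erase _ _ (Finset.mem_univ t),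
    ← Finset.mul_prod_erase _ _ (Finset.mem_univ t)]
  simp only [Function.update_self, measure_univ, one_mul]
  rw [mul_comm]
  congr 1
  exact Finset.prod_congr rfl fun i hi => by rw [Function.update_of_ne (Finset.ne_of_mem_erase hi)]

/-- A bound on the conditional expectation given all coordinates but one. -/
lemma integral_pi_le_of_update (t : Fin T) {H : (Fin T → Ω) → ℝ} (hH : Measurable H) {a b c : ℝ}
    (hb : ∀ γ, H γ ∈ Set.Icc a b) (h : ∀ γ, ∫ x, H (Function.update γ t x) ∂(P t) ≤ c) :
    ∫ γ, H γ ∂(Measure.pi P) ≤ c := by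
  have hmp := measurePreserving_update P t
  have hint : Integrable (fun q : (Fin T → Ω) × Ω => H (Function.update q.1 t q.2))
      ((Measure.pi P).prod (P t)) :=
    integrable_of_mem_Icc (hH.comp hmp.measurable) fun q => hb _
  calc ∫ γ, H γ ∂(Measure.pi P)
      = ∫ q, H (Function.update q.1 t q.2) ∂((Measure.pi P).prod (P t)) := by
        rw [← hmp.map_eq, integral_map hmp.measurable.aemeasurable hH.aestronglyMeasurable,
          hmp.map_eq]
    _ = ∫ γ, ∫ x, H (Function.update γ t x) ∂(P t) ∂(Measure.pi P) := integral_prod _ hint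
    _ ≤ ∫ _γ, c ∂(Measure.pi P) := integral_mono hint.integral_prod_left (integrable_const c) h
    _ = c := by simp

end Resample

/-! ### Leaving a round out of the weight -/

section LeaveOneOut
variable {Z : Type*} {T : ℕ}

/-- The weight `1 / (1 + ξ)` with round `t` left out of the maximum and the minimum: there, the
error is replaced by `0` and the value by `1`. -/
noncomputable def looWeight (vhat : Fin T → ℝ) (γ : Fin T → Request Z) (t : Fin T) : ℝ :=
  1 / (1 + (⨆ s, if s = t then 0 else |vhat s - (γ s).value|) /
    ⨅ s, if s = t then 1 else (γ s).value)

variable (vhat : Fin T → ℝ) (γ : Fin T → Request Z) (t : Fin T)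

lemma looWeight_mem : looWeight vhat γ t ∈ Set.Icc (0 : ℝ) 1 := by
  have h : 0 ≤ (⨆ s, if s = t then 0 else |vhat s - (γ s).value|) /
      ⨅ s, if s = t then 1 else (γ s).value := by
    refine div_nonneg (Real.iSup_nonneg fun s => ?_) (Real.iInf_nonneg fun s => ?_)
    · split_ifs
      exacts [le_rfl, abs_nonneg _]
    · split_ifs
      exacts [zero_le_one, (γ s).value_nonneg]
  rw [looWeight]
  exact ⟨by positivity, by rw [div_le_one (by linarith)]; linarith⟩

variable {vhat γ}

lemma weight_le_looWeight (hγ : ∀ t, 0 < (γ t).value) :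
    1 / (1 + xi vhat γ) ≤ looWeight vhat γ t := by
  have : Nonempty (Fin T) := ⟨t⟩
  have hinf : 0 < ⨅ s, (γ s).value := by
    obtain ⟨i, hi⟩ := exists_eq_ciInf_of_finite (f := fun t => (γ t).value)
    rw [← hi]; exact hγ i
  have h1 : (⨆ s, if s = t then 0 else |vhat s - (γ s).value|) ≤ ⨆ s, |vhat s - (γ s).value| := by
    refine ciSup_mono (Set.finite_range _).bddAbove fun s => ?_
    split_ifs
    exacts [abs_nonneg _, le_rfl]
  have h2 : (⨅ s, (γ s).value) ≤ ⨅ s, if s = t then 1 else (γ s).value := by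
    refine ciInf_mono (Set.finite_range _).bddBelow fun s => ?_
    split_ifs
    exacts [(γ s).value_le_one, le_rfl]
  have h3 : 0 ≤ ⨆ s, if s = t then 0 else |vhat s - (γ s).value| := Real.iSup_nonneg fun s => by
    split_ifs
    exacts [le_rfl, abs_nonneg _]
  have h4 : 0 ≤ ⨆ s, |vhat s - (γ s).value| := h3.trans h1
  rw [looWeight, xi]
  have h5 : 0 < ⨅ s, if s = t then 1 else (γ s).value := hinf.trans_le h2
  refine one_div_le_one_div_of_le (by positivity) ?_
  have := div_le_div₀ h4 h1 hinf h2
  linarith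

/-- Leaving out a round that attains neither the maximum nor the minimum does not change the
weight. -/
lemma sum_looWeight_sub_le (hT : 1 ≤ T) (hγ : ∀ t, 0 < (γ t).value) :
    ∑ t, (looWeight vhat γ t - 1 / (1 + xi vhat γ)) ≤ 2 := by
  have : Nonempty (Fin T) := ⟨⟨0, hT⟩⟩
  obtain ⟨i, hi⟩ := exists_eq_ciSup_of_finite (f := fun t => |vhat t - (γ t).value|)
  obtain ⟨j, hj⟩ := exists_eq_ciInf_of_finite (f := fun t => (γ t).value)
  have hinf : 0 < ⨅ s, (γ s).value := by rw [← hj]; exact hγ j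
  have hxi := xi_nonneg vhat γ
  have hone : ∀ t, looWeight vhat γ t - 1 / (1 + xi vhat γ) ≤
      (if t = i then 1 else 0) + (if t = j then 1 else 0) := fun t => by
    have hle : looWeight vhat γ t - 1 / (1 + xi vhat γ) ≤ 1 := by
      have : 0 ≤ 1 / (1 + xi vhat γ) := by positivity
      linarith [(looWeight_mem vhat γ t).2]
    by_cases hti : t = i
    · rw [if_pos hti]
      split_ifs <;> linarith
    · by_cases htj : t = j
      · rw [if_pos htj, if_neg hti]
        linarith
      · rw [if_neg hti, if_neg htj, add_zero, sub_nonpos, looWeight, xi]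
        refine one_div_le_one_div_of_le ?_ ?_
        · exact add_pos_of_pos_of_nonneg one_pos hxi
        · have h1 : (⨆ s, |vhat s - (γ s).value|) ≤
              ⨆ s, if s = t then 0 else |vhat s - (γ s).value| := by
            rw [← hi]
            refine le_ciSup_of_le (Set.finite_range _).bddAbove i ?_
            rw [if_neg (Ne.symm hti)]
          have h2 : (⨅ s, if s = t then 1 else (γ s).value) ≤ ⨅ s, (γ s).value := by
            rw [← hj]
            refine ciInf_le_of_le (Set.finite_range _).bddBelow j ?_
            rw [if_neg (Ne.symm htj)]
          have h3 : 0 < ⨅ s, if s = t then 1 else (γ s).value := by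
            obtain ⟨k, hk⟩ := exists_eq_ciInf_of_finite
              (f := fun s => if s = t then 1 else (γ s).value)
            rw [← hk]
            split_ifs
            exacts [one_pos, hγ k]
          have h4 : 0 ≤ ⨆ s, |vhat s - (γ s).value| := Real.iSup_nonneg fun _ => abs_nonneg _
          have := div_le_div₀ (h4.trans h1) h1 h3 h2
          linarith
  refine (Finset.sum_le_sum fun t _ => hone t).trans ?_
  rw [Finset.sum_add_distrib]
  simp only [Finset.sum_ite_eq', Finset.mem_univ, if_true]
  norm_num

end LeaveOneOut

/-! ### Measurability of the run -/

section Measurability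
variable {Z : Type*} [MeasurableSpace Z] [MeasurableSpace TruthfulAuction] {T : ℕ}

lemma measurable_feature : Measurable (Request.feature : Request Z → Z) := measurable_fst
lemma measurable_value : Measurable (Request.value : Request Z → ℝ) :=
  measurable_subtype_coe.comp (measurable_fst.comp measurable_snd)
lemma measurable_auction : Measurable (Request.auction : Request Z → TruthfulAuction) :=
  measurable_snd.comp measurable_snd

variable (halloc : Measurable fun q : TruthfulAuction × ℝ≥0 => q.1.alloc q.2)
  (hpay : Measurable fun q : TruthfulAuction × ℝ≥0 => q.1.pay q.2)

include halloc hpay in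
lemma measurable_dualValue {α : Type*} [MeasurableSpace α] {l m : α → ℝ} {r : α → Request Z}
    (hl : Measurable l) (hm : Measurable m) (hr : Measurable r) :
    Measurable fun a => dualValue (l a) (m a) (r a) := by
  have hv := measurable_value.comp hr
  have hA := measurable_auction.comp hr
  have hb : Measurable fun a => Real.toNNReal ((1 + l a) / (m a + l a) * (r a).value) :=
    (((hl.const_add 1).div (hm.add hl)).mul hv).real_toNNReal
  exact (((hl.const_add 1).mul hv).mul (halloc.comp (hA.prodMk hb))).sub
    ((hl.add hm).mul (hpay.comp (hA.prodMk hb)))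

/-- The adjusted values of a sequence of requests, if that of round `t` is the function `vh t` of the
feature. -/
def valuesOf (vh : Fin T → Z → ℝ) (γ : Fin T → Request Z) : Fin T → ℝ :=
  fun t => vh t (γ t).feature

variable {vh : Fin T → Z → ℝ} (hvh : ∀ t, Measurable (vh t))

include hvh in
lemma measurable_valuesOf (t : Fin T) : Measurable fun γ : Fin T → Request Z => valuesOf vh γ t :=
  (hvh t).comp (measurable_feature.comp (measurable_pi_apply t))

lemma measurable_value_apply (t : Fin T) :
    Measurable fun γ : Fin T → Request Z => (γ t).value :=
  measurable_value.comp (measurable_pi_apply t)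

include halloc hpay hvh in
lemma measurable_stateAt (B : ℝ) {k : ℕ} (hk : k ≤ T) :
    (Measurable fun γ : Fin T → Request Z => (stateAt B (valuesOf vh γ) γ k).lam) ∧
    (Measurable fun γ : Fin T → Request Z => (stateAt B (valuesOf vh γ) γ k).mu) ∧
    Measurable fun γ : Fin T → Request Z => (stateAt B (valuesOf vh γ) γ k).budget := by
  induction k with
  | zero => exact ⟨measurable_const, measurable_const, measurable_const⟩
  | succ k ih =>
    obtain ⟨h1, h2, h3⟩ := ih (by omega)
    set t : Fin T := ⟨k, hk⟩ with ht
    have hv := measurable_valuesOf hvh t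
    have hb : Measurable fun γ : Fin T → Request Z => algBids B (valuesOf vh γ) γ t := by
      change Measurable fun γ => (stateAt B (valuesOf vh γ) γ k).bid (valuesOf vh γ t)
      exact Measurable.ite (measurableSet_le measurable_const h3)
        (((h1.const_add 1).div (h2.add h1)).mul hv).real_toNNReal measurable_const
    have hA : Measurable fun γ : Fin T → Request Z => (γ t).auction :=
      measurable_auction.comp (measurable_pi_apply t)
    have hx : Measurable fun γ : Fin T → Request Z =>
      (γ t).auction.alloc (algBids B (valuesOf vh γ) γ t) := halloc.comp (hA.prodMk hb)
    have hp : Measurable fun γ : Fin T → Request Z =>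
      (γ t).auction.pay (algBids B (valuesOf vh γ) γ t) := hpay.comp (hA.prodMk hb)
    refine ⟨?_, ?_, ?_⟩
    · have h := fun γ : Fin T → Request Z => lam_succ B (valuesOf vh γ) (fun t => (γ t).auction) t
      simp only [stateAt]
      change Measurable fun γ => (algState B _ _ ((t : ℕ) + 1)).lam
      simp only [h]
      exact h1.mul (((hv.mul hx).sub hp).const_mul _).exp
    · have h := fun γ : Fin T → Request Z => mu_succ B (valuesOf vh γ) (fun t => (γ t).auction) t
      simp only [stateAt]
      change Measurable fun γ => (algState B _ _ ((t : ℕ) + 1)).mu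
      simp only [h]
      exact measurable_const.max (h2.sub ((hp.const_sub _).const_mul _))
    · have h := fun γ : Fin T → Request Z =>
        budget_succ B (valuesOf vh γ) (fun t => (γ t).auction) t
      simp only [stateAt]
      change Measurable fun γ => (algState B _ _ ((t : ℕ) + 1)).budget
      simp only [h]
      exact h3.sub hp

include hvh in
lemma measurable_under (t : Fin T) :
    Measurable fun γ : Fin T → Request Z => under (valuesOf vh γ) γ t :=
  Measurable.ite (measurableSet_lt (measurable_valuesOf hvh t) (measurable_value_apply t))
    measurable_const measurable_const

include halloc hpay hvh in
lemma measurableSet_active (B : ℝ) {k : ℕ} (hk : k ≤ T) :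
    MeasurableSet {γ : Fin T → Request Z | Active B (valuesOf vh γ) γ k} := by
  simp only [Active, Set.ofPred_and]
  refine (measurableSet_le measurable_const (measurable_stateAt halloc hpay hvh B hk).2.2).inter
    (measurableSet_le ?_ measurable_const)
  refine Finset.measurable_sum _ fun t _ => ?_
  by_cases h : (t : ℕ) < k
  · simpa [h] using measurable_under hvh t
  · simp [h]

include halloc hpay hvh in
lemma measurable_dualGap (B lam mu : ℝ) (t : Fin T) :
    Measurable fun γ : Fin T → Request Z => dualGap B (valuesOf vh γ) lam mu γ t := by
  obtain ⟨h1, h2, -⟩ := measurable_stateAt halloc hpay hvh B t.2.le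
  refine ((measurable_dualValue halloc hpay measurable_const measurable_const
    (measurable_pi_apply t)).add_const _).sub (Measurable.ite
      (measurableSet_active halloc hpay hvh B t.2.le) ?_ measurable_const)
  exact (measurable_dualValue halloc hpay h1 h2 (measurable_pi_apply t)).add (h2.mul_const _)

include hvh in
lemma measurable_looWeight (t : Fin T) :
    Measurable fun γ : Fin T → Request Z => looWeight (valuesOf vh γ) γ t := by
  refine measurable_const.div (measurable_const.add (Measurable.div ?_ ?_))
  · refine Measurable.iSup fun s => ?_
    by_cases h : s = t
    · simp [h]
    · simp only [h, if_false]
      exact continuous_abs.measurable.comp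
        ((measurable_valuesOf hvh s).sub (measurable_value_apply s))
  · refine Measurable.iInf fun s => ?_
    by_cases h : s = t
    · simp [h]
    · simpa [h] using measurable_value_apply s

omit [MeasurableSpace Z] [MeasurableSpace TruthfulAuction] in
lemma looWeight_update (γ : Fin T → Request Z) (t : Fin T) (x : Request Z) :
    looWeight (valuesOf vh (Function.update γ t x)) (Function.update γ t x) t =
      looWeight (valuesOf vh γ) γ t := by
  have h : ∀ s, s ≠ t → Function.update γ t x s = γ s := fun s hs => Function.update_of_ne hs _ _
  have h1 : ∀ s, (if s = t then 0 else |valuesOf vh (Function.update γ t x) s -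
      (Function.update γ t x s).value|) = if s = t then 0 else |valuesOf vh γ s - (γ s).value| :=
    fun s => by
      split_ifs with hs
      · rfl
      · simp only [valuesOf, h s hs]
  have h2 : ∀ s, (if s = t then 1 else (Function.update γ t x s).value) =
      if s = t then 1 else (γ s).value := fun s => by
    split_ifs with hs
    · rfl
    · rw [h s hs]
  simp only [looWeight, h1, h2]

omit [MeasurableSpace Z] [MeasurableSpace TruthfulAuction] in
lemma stateAt_update (B : ℝ) (γ : Fin T → Request Z) (t : Fin T) (x : Request Z) :
    stateAt B (valuesOf vh (Function.update γ t x)) (Function.update γ t x) t =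
      stateAt B (valuesOf vh γ) γ t := by
  refine algState_congr B _ _ fun s hs => ?_
  have : Function.update γ t x s = γ s :=
    Function.update_of_ne (fun h => by rw [h] at hs; exact lt_irrefl _ hs) _ _
  simp only [valuesOf, this, and_self]

omit [MeasurableSpace Z] [MeasurableSpace TruthfulAuction] in
lemma active_update (B : ℝ) (γ : Fin T → Request Z) (t : Fin T) (x : Request Z) :
    Active B (valuesOf vh (Function.update γ t x)) (Function.update γ t x) t ↔
      Active B (valuesOf vh γ) γ t := by
  have : underCount (valuesOf vh (Function.update γ t x)) (Function.update γ t x) t =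
      underCount (valuesOf vh γ) γ t := by
    refine Finset.sum_congr rfl fun s _ => ?_
    split_ifs with hs
    · have : Function.update γ t x s = γ s :=
        Function.update_of_ne (fun h => by rw [h] at hs; exact lt_irrefl _ hs) _ _
      simp only [under, valuesOf, this]
      rfl
    · rfl
  rw [Active, Active, stateAt_update, this]

end Measurability

/-! ### The expected regret for fixed adjusted values -/

section ExpectedRegret
variable {Z : Type*} {T : ℕ}

lemma stateAt_mu_mul_le {B C : ℝ} (vhat : Fin T → ℝ) (γ : Fin T → Request Z) (hT : 1 ≤ T)
    (hB : 0 ≤ B / T) (hBC : B / T ≤ C) (t : Fin T) :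
    (stateAt B vhat γ t).mu * (B / T) ∈ Set.Icc 0 (C * √(T : ℝ)) := by
  have hT0 : (0 : ℝ) < T := by exact_mod_cast hT
  have hs : 0 < √(T : ℝ) := Real.sqrt_pos.2 hT0
  have hB0 : 0 ≤ B := by
    have := mul_nonneg hB hT0.le
    rwa [div_mul_cancel₀ _ hT0.ne'] at this
  have h0 : 0 ≤ (stateAt B vhat γ t).mu := mu_nonneg B vhat _ t.2.le
  have h1 : (stateAt B vhat γ t).mu ≤ √(T : ℝ) := by
    refine (mu_le B vhat _ hB0 t.2.le).trans ?_
    rw [div_le_iff₀ hs, Real.mul_self_sqrt hT0.le]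
    exact_mod_cast t.2.le
  refine ⟨mul_nonneg h0 hB, ?_⟩
  rw [mul_comm C]
  exact mul_le_mul h1 hBC hB hs.le

lemma dualGap_mem {B C lam mu : ℝ} {vhat : Fin T → ℝ} {γ : Fin T → Request Z} (hT : 1 ≤ T)
    (hv : ∀ t, vhat t ∈ Set.Icc (-1 : ℝ) 2) (hB : 0 ≤ B / T) (hBC : B / T ≤ C) (hlam : 0 < lam)
    (hmu : 0 ≤ mu) (t : Fin T) :
    dualGap B vhat lam mu γ t ∈ Set.Icc (-((19 + C) * √(T : ℝ))) (1 + lam + mu * (B / T)) := by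
  have hs1 : 1 ≤ √(T : ℝ) := Real.one_le_sqrt.2 (by exact_mod_cast hT)
  have hl : 0 < (stateAt B vhat γ t).lam := lam_pos B vhat _ t.2.le
  have hm : 0 ≤ (stateAt B vhat γ t).mu := mu_nonneg B vhat _ t.2.le
  have h1 := dualValue_nonneg hlam hmu (γ t)
  have h2 := dualValue_le hlam hmu (γ t)
  have h3 := dualValue_nonneg hl hm (γ t)
  have h4 := dualValue_le hl hm (γ t)
  obtain ⟨h5, h6⟩ := stateAt_mu_mul_le vhat γ hT hB hBC t
  have h7 : 0 ≤ mu * (B / T) := mul_nonneg hmu hB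
  have h8 : 0 ≤ C * √(T : ℝ) := h5.trans h6
  rw [dualGap]
  split_ifs with h
  · have h9 := lam_le_of_active hv h
    constructor <;> linarith
  · constructor <;> linarith

variable [MeasurableSpace Z] [MeasurableSpace TruthfulAuction]
  (halloc : Measurable fun q : TruthfulAuction × ℝ≥0 => q.1.alloc q.2)
  (hpay : Measurable fun q : TruthfulAuction × ℝ≥0 => q.1.pay q.2)

include halloc hpay in
/-- The dual objective has an approximate minimizer among the multipliers with `0 < λ ≤ Λ`. -/
lemma exists_dual_minimizer (Q : Measure (Request Z)) [IsProbabilityMeasure Q] {Λ ρ ε : ℝ}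
    (hΛ : 1 ≤ Λ) (hρ : 0 ≤ ρ) (hε : 0 < ε) :
    ∃ lam mu : ℝ, 0 < lam ∧ lam ≤ Λ ∧ 0 ≤ mu ∧
      (∀ l m : ℝ, 0 < l → l ≤ Λ → 0 ≤ m → ∫ x, dualValue lam mu x ∂Q + mu * ρ ≤
        ∫ x, dualValue l m x ∂Q + m * ρ + ε) ∧
      ∫ x, dualValue lam mu x ∂Q + mu * ρ ≤ 2 + ε := by
  set s : Set ℝ := {a | ∃ l m : ℝ, 0 < l ∧ l ≤ Λ ∧ 0 ≤ m ∧ a = ∫ x, dualValue l m x ∂Q + m * ρ}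
  have hbdd : BddBelow s := by
    refine ⟨0, ?_⟩
    rintro _ ⟨l, m, hl, -, hm, rfl⟩
    exact add_nonneg (integral_nonneg fun x => dualValue_nonneg hl hm x) (mul_nonneg hm hρ)
  have hne : s.Nonempty := ⟨_, 1, 0, one_pos, hΛ, le_rfl, rfl⟩
  obtain ⟨_, ⟨lam, mu, h1, h2, h3, rfl⟩, h4⟩ :=
    exists_lt_of_csInf_lt hne (lt_add_of_pos_right (sInf s) hε)
  have hmin : ∀ l m : ℝ, 0 < l → l ≤ Λ → 0 ≤ m → ∫ x, dualValue lam mu x ∂Q + mu * ρ ≤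
      ∫ x, dualValue l m x ∂Q + m * ρ + ε := fun l m hl hl' hm => by
    have := csInf_le hbdd ⟨l, m, hl, hl', hm, rfl⟩
    linarith
  refine ⟨lam, mu, h1, h2, h3, hmin, ?_⟩
  have h5 := hmin 1 0 one_pos hΛ le_rfl
  have h6 : ∫ x, dualValue 1 0 x ∂Q ≤ ∫ _x : Request Z, (2 : ℝ) ∂Q := by
    refine integral_mono (integrable_of_mem_Icc (measurable_dualValue halloc hpay measurable_const
      measurable_const measurable_id) (a := 0) (b := 2) fun x => ⟨dualValue_nonneg one_pos le_rfl x,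
        ?_⟩) (integrable_const _) fun x => ?_
    all_goals
      have := dualValue_le one_pos le_rfl (mu := 0) x
      norm_num at this
      exact this
  rw [integral_const, probReal_univ, one_smul] at h6
  linarith

variable (P : Fin T → Measure (Request Z)) [∀ t, IsProbabilityMeasure (P t)]
  {vh : Fin T → Z → ℝ} (hvh : ∀ t, Measurable (vh t)) (hvh' : ∀ t z, vh t z ∈ Set.Icc (-1 : ℝ) 2)

include halloc hpay hvh hvh' in
/-- Given the other rounds, the weight without round `t`, the multipliers of the algorithm and
whether the round is active are fixed, so near optimality of `(λ, μ)` for the law `Q` bounds the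
conditional expectation. -/
lemma integral_looWeight_mul_dualGap_le (Q : Measure (Request Z)) [IsProbabilityMeasure Q]
    {B C lam mu : ℝ} (hT : 1 ≤ T) (hB : 0 ≤ B / T) (hBC : B / T ≤ C) (hlam : 0 < lam)
    (hlam' : lam ≤ 15 * √(T : ℝ)) (hmu : 0 ≤ mu) {ε : ℝ} (hε : 0 ≤ ε) (hε1 : ε ≤ 1)
    (hmin : ∀ l m : ℝ, 0 < l → l ≤ 15 * √(T : ℝ) → 0 ≤ m →
      ∫ x, dualValue lam mu x ∂Q + mu * (B / T) ≤ ∫ x, dualValue l m x ∂Q + m * (B / T) + ε)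
    (hmin' : ∫ x, dualValue lam mu x ∂Q + mu * (B / T) ≤ 2 + ε) (t : Fin T) :
    ∫ γ, looWeight (valuesOf vh γ) γ t * dualGap B (valuesOf vh γ) lam mu γ t ∂(Measure.pi P) ≤
      ε + 32 * √(T : ℝ) * tvDist (P t) Q := by
  have hs1 : 1 ≤ √(T : ℝ) := Real.one_le_sqrt.2 (by exact_mod_cast hT)
  have hv : ∀ (γ : Fin T → Request Z) t, valuesOf vh γ t ∈ Set.Icc (-1 : ℝ) 2 :=
    fun γ t => hvh' t _
  have hgap := fun γ : Fin T → Request Z =>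
    dualGap_mem (γ := γ) hT (hv γ) hB hBC hlam hmu t
  have htv : 0 ≤ tvDist (P t) Q := tvDist_nonneg
  have hC : 0 ≤ C := hB.trans hBC
  have hmeas : ∀ l m : ℝ, Measurable fun x : Request Z => dualValue l m x := fun l m =>
    measurable_dualValue halloc hpay measurable_const measurable_const measurable_id
  have hmem : ∀ l m : ℝ, 0 < l → l ≤ 15 * √(T : ℝ) → 0 ≤ m →
      ∀ x : Request Z, dualValue l m x ∈ Set.Icc 0 (16 * √(T : ℝ)) := fun l m hl hl' hm x =>
    ⟨dualValue_nonneg hl hm x, (dualValue_le hl hm x).trans (by linarith)⟩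
  have hXmeas : Measurable fun γ : Fin T → Request Z =>
      looWeight (valuesOf vh γ) γ t * dualGap B (valuesOf vh γ) lam mu γ t :=
    (measurable_looWeight hvh t).mul (measurable_dualGap halloc hpay hvh B lam mu t)
  refine integral_pi_le_of_update P t hXmeas
    (a := -((19 + C) * √(T : ℝ))) (b := 1 + lam + mu * (B / T)) (fun γ => ?_) fun γ => ?_
  · obtain ⟨hw0, hw1⟩ := looWeight_mem (valuesOf vh γ) γ t
    obtain ⟨hg0, hg1⟩ := hgap γ
    have h1 : 0 ≤ (19 + C) * √(T : ℝ) := by positivity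
    have h2 : 0 ≤ 1 + lam + mu * (B / T) := by positivity
    constructor <;> nlinarith
  · simp only [looWeight_update]
    rw [integral_const_mul]
    obtain ⟨hw0, hw1⟩ := looWeight_mem (valuesOf vh γ) γ t
    have hε' : 0 ≤ ε + 32 * √(T : ℝ) * tvDist (P t) Q := by positivity
    refine le_trans (mul_le_mul_of_nonneg_left ?_ hw0) (mul_le_of_le_one_left hε' hw1)
    have hint : ∀ l m κ : ℝ, 0 < l → l ≤ 15 * √(T : ℝ) → 0 ≤ m →
        Integrable (fun x => dualValue l m x + κ) (P t) ∧
        ∫ x, (dualValue l m x + κ) ∂(P t) = ∫ x, dualValue l m x ∂(P t) + κ :=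
      fun l m κ h1 h2 h3 => by
        have h := integrable_of_mem_Icc (μ := P t) (hmeas l m) (hmem l m h1 h2 h3)
        refine ⟨h.add (integrable_const κ), ?_⟩
        rw [integral_add h (integrable_const κ), integral_const, probReal_univ, one_smul]
    obtain ⟨hint1, hint2⟩ := hint lam mu (mu * (B / T)) hlam hlam' hmu
    have hstar := integral_le_integral_add_tvDist (μ := P t) (ν := Q) (hmeas lam mu)
      (hmem lam mu hlam hlam' hmu)
    simp only [dualGap, Function.update_self, stateAt_update]
    by_cases h : Active B (valuesOf vh γ) γ t
    · simp only [if_pos ((active_update B γ t _).2 h)]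
      have hl := lam_le_of_active (hv γ) h
      have hl0 : 0 < (stateAt B (valuesOf vh γ) γ t).lam := lam_pos B _ _ t.2.le
      have hm0 : 0 ≤ (stateAt B (valuesOf vh γ) γ t).mu := mu_nonneg B _ _ t.2.le
      set l := (stateAt B (valuesOf vh γ) γ t).lam
      set m := (stateAt B (valuesOf vh γ) γ t).mu
      have halg := integral_le_integral_add_tvDist (μ := Q) (ν := P t) (hmeas l m)
        (hmem l m hl0 hl hm0)
      have hsymm : tvDist Q (P t) = tvDist (P t) Q := by simp only [tvDist, abs_sub_comm]
      rw [hsymm] at halg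
      obtain ⟨hint3, hint4⟩ := hint l m (m * (B / T)) hl0 hl hm0
      rw [integral_sub hint1 hint3, hint2, hint4]
      linarith [hmin l m hl0 hl hm0]
    · simp only [if_neg fun h' => h ((active_update B γ t _).1 h')]
      rw [integral_sub hint1 (integrable_const _), hint2, integral_const, probReal_univ, one_smul]
      have : 0 ≤ 16 * √(T : ℝ) * tvDist (P t) Q := by positivity
      linarith

lemma isProbabilityMeasure_averageLaw (hT : 1 ≤ T) : IsProbabilityMeasure (averageLaw P) := by
  refine ⟨?_⟩
  rw [averageLaw, Measure.smul_apply, Measure.coe_finsetSum, Finset.sum_apply]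
  simp only [measure_univ, Finset.sum_const, Finset.card_univ, Fintype.card_fin, nsmul_eq_mul,
    mul_one, smul_eq_mul]
  exact ENNReal.inv_mul_cancel (by simpa using by omega) (ENNReal.natCast_ne_top T)

include halloc hpay hvh hvh' in
/-- If the expected number of underestimated rounds is at most one, the expected regret is of order
`√T`. The weight `1 / (1 + ξ)` depends on all rounds; it is replaced by the weights without round
`t`, which changes the weighted sum of the dual gaps by at most twice a bound on a single gap. -/
lemma expectationLE_regret {B c C K : ℝ} (hT : 1 ≤ T) (hc : 0 < c) (hcB : c ≤ B / T)
    (hBC : B / T ≤ C) (hpos : ∀ t, ∀ᵐ γ ∂(P t), 0 < γ.value) (hMD : meanDeviation P ≤ K)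
    (hunder : ∑ t, (P t).real {x | vh t x.feature < x.value} ≤ 1) :
    ExpectationLE (Measure.pi P) (fun γ => 1 / (1 + xi (valuesOf vh γ) γ) * optReward B γ -
        reward (algBids B (valuesOf vh γ) γ) γ)
      ((1 + 32 * K + 2 * (19 + C) + 2 * (3 / c + 5 / c ^ 2 + 125)) * √(T : ℝ)) := by
  have hT0 : (0 : ℝ) < T := by exact_mod_cast hT
  have hs1 : 1 ≤ √(T : ℝ) := Real.one_le_sqrt.2 (by exact_mod_cast hT)
  have hs0 : 0 < √(T : ℝ) := by linarith
  have hss := Real.mul_self_sqrt hT0.le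
  have hB : 0 ≤ B / T := hc.le.trans hcB
  have hC : 0 ≤ C := hB.trans hBC
  have hQ := isProbabilityMeasure_averageLaw P hT
  have hK : 0 ≤ K := le_trans (Finset.sum_nonneg fun t _ => tvDist_nonneg) hMD
  have hc1 : 0 ≤ 3 / c := by positivity
  have hc2 : 0 ≤ 5 / c ^ 2 := by positivity
  set M₁ := 3 / c + 5 / c ^ 2 + 125 with hM₁
  rcases lt_or_ge T 16 with hT16 | hT16
  · -- a short run loses at most `T ≤ 4 √T`
    refine ⟨fun _ => T, integrable_const _, Filter.Eventually.of_forall fun γ => ?_, ?_⟩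
    · have hxi := xi_nonneg (valuesOf vh γ) γ
      have h1 : 1 / (1 + xi (valuesOf vh γ) γ) ≤ 1 := by rw [div_le_one (by linarith)]; linarith
      have h2 : 0 ≤ 1 / (1 + xi (valuesOf vh γ) γ) := by positivity
      have h3 := mul_le_mul_of_nonneg_left (optReward_le_card B γ) h2
      have h4 := mul_le_of_le_one_left hT0.le h1
      linarith [reward_nonneg (algBids B (valuesOf vh γ) γ) γ]
    · simp only [integral_const, probReal_univ, one_smul]
      have h1 : √(T : ℝ) ≤ 4 := by
        rw [Real.sqrt_le_left (by norm_num)]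
        norm_num
        exact_mod_cast hT16.le
      have h2 : √(T : ℝ) * √(T : ℝ) ≤ 4 * √(T : ℝ) := mul_le_mul_of_nonneg_right h1 hs0.le
      rw [hss] at h2
      refine h2.trans (mul_le_mul_of_nonneg_right ?_ hs0.le)
      linarith
  · obtain ⟨lam, mu, hlam, hlam', hmu, hmin, hmin'⟩ := exists_dual_minimizer halloc hpay
      (averageLaw P) (Λ := 15 * √(T : ℝ)) (ρ := B / T) (ε := 1 / √(T : ℝ)) (by linarith) hB
      (by positivity)
    have hε1 : 1 / √(T : ℝ) ≤ 1 := by rw [div_le_one hs0]; exact hs1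
    have hv : ∀ (γ : Fin T → Request Z) t, valuesOf vh γ t ∈ Set.Icc (-1 : ℝ) 2 :=
      fun γ t => hvh' t _
    set X : Fin T → (Fin T → Request Z) → ℝ := fun t γ =>
      looWeight (valuesOf vh γ) γ t * dualGap B (valuesOf vh γ) lam mu γ t with hX
    have hgap := fun (γ : Fin T → Request Z) t =>
      dualGap_mem (γ := γ) hT (hv γ) hB hBC hlam hmu t
    have hXint : ∀ t, Integrable (X t) (Measure.pi P) := fun t => by
      have hXmeas : Measurable (X t) :=
        (measurable_looWeight hvh t).mul (measurable_dualGap halloc hpay hvh B lam mu t)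
      refine integrable_of_mem_Icc hXmeas (a := -((19 + C) * √(T : ℝ)))
        (b := 1 + lam + mu * (B / T)) fun γ => ?_
      change looWeight (valuesOf vh γ) γ t * dualGap B (valuesOf vh γ) lam mu γ t ∈ _
      obtain ⟨hw0, hw1⟩ := looWeight_mem (valuesOf vh γ) γ t
      obtain ⟨hg0, hg1⟩ := hgap γ t
      have h1 : 0 ≤ (19 + C) * √(T : ℝ) := by positivity
      have h2 : 0 ≤ 1 + lam + mu * (B / T) := by positivity
      constructor <;> nlinarith
    have hUint : ∀ t, Integrable (fun γ => under (valuesOf vh γ) γ t) (Measure.pi P) := fun t =>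
      integrable_of_mem_Icc (measurable_under hvh t) (a := 0) (b := 1) fun γ => by
        rw [under]; split_ifs <;> simp
    have hU : ∀ t, ∫ γ, under (valuesOf vh γ) γ t ∂(Measure.pi P) =
        (P t).real {x | vh t x.feature < x.value} := fun t => by
      have hset : MeasurableSet {x : Request Z | vh t x.feature < x.value} :=
        measurableSet_lt ((hvh t).comp measurable_feature) measurable_value
      have h1 : (fun γ : Fin T → Request Z => under (valuesOf vh γ) γ t) =
          Set.indicator (Function.eval t ⁻¹' {x : Request Z | vh t x.feature < x.value}) 1 := by
        ext γ
        by_cases h : vh t (γ t).feature < (γ t).value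
        · rw [Set.indicator_of_mem (by exact h), under, valuesOf, if_pos h, Pi.one_apply]
        · rw [Set.indicator_of_notMem (by exact h), under, valuesOf, if_neg h]
      rw [h1, integral_indicator_one (hset.preimage (measurable_pi_apply t)),
        (measurePreserving_eval P t).measureReal_preimage hset.nullMeasurableSet]
    have hXsum := integrable_finsetSum Finset.univ fun t _ => hXint t
    have hUsum := integrable_finsetSum Finset.univ fun t _ => hUint t
    have hUc := ((integrable_const (1 : ℝ)).add hUsum).const_mul (M₁ * √(T : ℝ))
    refine ⟨fun γ => (∑ t, X t γ + 2 * ((19 + C) * √(T : ℝ))) +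
      M₁ * √(T : ℝ) * (1 + ∑ t, under (valuesOf vh γ) γ t),
      (hXsum.add (integrable_const _)).add hUc, ?_, ?_⟩
    · have hae : ∀ᵐ γ ∂(Measure.pi P), ∀ t, 0 < (γ t).value := by
        rw [ae_all_iff]
        exact fun t => (measurePreserving_eval P t).quasiMeasurePreserving.ae (hpos t)
      filter_upwards [hae] with γ hγ
      refine (regret_le_sum_dualGap hT16 hc hcB (hv γ) hγ hlam hmu).trans ?_
      have h1 : ∑ t, 1 / (1 + xi (valuesOf vh γ) γ) * dualGap B (valuesOf vh γ) lam mu γ t ≤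
          ∑ t, (X t γ + (looWeight (valuesOf vh γ) γ t - 1 / (1 + xi (valuesOf vh γ) γ)) *
            ((19 + C) * √(T : ℝ))) := Finset.sum_le_sum fun t _ => by
        have h2 := sub_nonneg.2 (weight_le_looWeight (vhat := valuesOf vh γ) t hγ)
        have h3 := mul_le_mul_of_nonneg_left (hgap γ t).1 h2
        simp only [hX]
        linarith
      have h2 := mul_le_mul_of_nonneg_right (sum_looWeight_sub_le (vhat := valuesOf vh γ) hT hγ)
        (by positivity : 0 ≤ (19 + C) * √(T : ℝ))
      rw [Finset.sum_add_distrib, ← Finset.sum_mul, ← Finset.mul_sum] at h1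
      linarith
    · have hXle : ∑ t, ∫ γ, X t γ ∂(Measure.pi P) ≤ √(T : ℝ) + 32 * K * √(T : ℝ) := by
        calc ∑ t, ∫ γ, X t γ ∂(Measure.pi P)
            ≤ ∑ t, (1 / √(T : ℝ) + 32 * √(T : ℝ) * tvDist (P t) (averageLaw P)) :=
              Finset.sum_le_sum fun t _ => integral_looWeight_mul_dualGap_le halloc hpay P hvh hvh'
                (averageLaw P) hT hB hBC hlam hlam' hmu (by positivity) hε1 hmin hmin' t
          _ = √(T : ℝ) + 32 * √(T : ℝ) * meanDeviation P := by
              rw [Finset.sum_add_distrib, ← Finset.mul_sum, meanDeviation]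
              simp only [Finset.sum_const, Finset.card_univ, Fintype.card_fin, nsmul_eq_mul]
              congr 1
              rw [mul_one_div, div_eq_iff hs0.ne', hss]
          _ ≤ _ := by
              have := mul_le_mul_of_nonneg_left hMD (by positivity : 0 ≤ 32 * √(T : ℝ))
              linarith
      have hUle : ∑ t, ∫ γ, under (valuesOf vh γ) γ t ∂(Measure.pi P) ≤ 1 := by
        simpa only [hU] using hunder
      have h1 : ∫ γ, (∑ t, X t γ + 2 * ((19 + C) * √(T : ℝ))) ∂(Measure.pi P) =
          ∑ t, ∫ γ, X t γ ∂(Measure.pi P) + 2 * ((19 + C) * √(T : ℝ)) := by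
        rw [integral_add hXsum (integrable_const _), integral_finsetSum _ fun t _ => hXint t,
          integral_const, probReal_univ, one_smul]
      have h2 : ∫ γ, M₁ * √(T : ℝ) * (1 + ∑ t, under (valuesOf vh γ) γ t) ∂(Measure.pi P) =
          M₁ * √(T : ℝ) * (1 + ∑ t, ∫ γ, under (valuesOf vh γ) γ t ∂(Measure.pi P)) := by
        rw [integral_const_mul, integral_add (integrable_const _) hUsum,
          integral_finsetSum _ fun t _ => hUint t, integral_const, probReal_univ, one_smul]
      refine ((integral_add (hXsum.add (integrable_const _)) hUc).trans
        (congrArg₂ (· + ·) h1 h2)).trans_le ?_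
      have := mul_le_mul_of_nonneg_left hUle (by positivity : 0 ≤ M₁ * √(T : ℝ))
      linarith

end ExpectedRegret

/-! ### Weighted quantiles -/

section Quantile
variable {n : ℕ} {β : ℝ} {ω : Fin n → ℝ} {ωInf : ℝ} {s : Fin n → ℝ}

/-- The quantile of scores in `[-1, 1]` is a real number in `[-1, 1]`, and a score exceeds it only if
the scores below it have mass at least `1 - β`. -/
lemma weightedQuantile_spec (hβ : β < 1) (hω : ∀ j, 0 ≤ ω j) (hsum : ∑ j, ω j + ωInf = 1)
    (hInf : ωInf ≤ β) (hs : ∀ j, s j ∈ Set.Icc (-1 : ℝ) 1) :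
    (weightedQuantile (1 - β) ω ωInf s).toReal ∈ Set.Icc (-1 : ℝ) 1 ∧
      ∀ x : ℝ, (weightedQuantile (1 - β) ω ωInf s).toReal < x →
        1 - β ≤ ∑ j, if s j < x then ω j else 0 := by
  classical
  set q := weightedQuantile (1 - β) ω ωInf s with hq
  set S : Set EReal := {q : EReal | 1 - β ≤ (∑ j, if (s j : EReal) ≤ q then ω j else 0) +
    if q = ⊤ then ωInf else 0} with hS
  have hqS : q = sInf S := by
    simp only [hq, weightedQuantile, hS]
  have hle : q ≤ ((1 : ℝ) : EReal) := by
    rw [hqS]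
    refine sInf_le ?_
    change 1 - β ≤ (∑ j, if (s j : EReal) ≤ ((1 : ℝ) : EReal) then ω j else 0) +
      if ((1 : ℝ) : EReal) = ⊤ then ωInf else 0
    have h : ∀ j, (if (s j : EReal) ≤ ((1 : ℝ) : EReal) then ω j else 0) = ω j := fun j =>
      if_pos (EReal.coe_le_coe_iff.2 (hs j).2)
    rw [Finset.sum_congr rfl fun j _ => h j, if_neg (EReal.coe_ne_top 1)]
    linarith
  have hge : ((-1 : ℝ) : EReal) ≤ q := by
    rw [hqS]
    refine le_sInf fun a ha => ?_
    by_contra! hlt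
    have ha : 1 - β ≤ (∑ j, if (s j : EReal) ≤ a then ω j else 0) + if a = ⊤ then ωInf else 0 := ha
    have h : ∀ j, (if (s j : EReal) ≤ a then ω j else 0) = 0 := fun j =>
      if_neg (not_le.2 (hlt.trans_le (EReal.coe_le_coe_iff.2 (hs j).1)))
    rw [Finset.sum_congr rfl fun j _ => h j, if_neg (hlt.trans_le le_top).ne] at ha
    simp only [Finset.sum_const_zero, add_zero] at ha
    linarith
  have htop : q ≠ ⊤ := (hle.trans_lt (EReal.coe_lt_top 1)).ne
  have hbot : q ≠ ⊥ := ((EReal.bot_lt_coe (-1)).trans_le hge).ne'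
  have hcoe : (q.toReal : EReal) = q := EReal.coe_toReal htop hbot
  refine ⟨⟨?_, ?_⟩, fun x hx => ?_⟩
  · rwa [← EReal.coe_le_coe_iff, hcoe]
  · rwa [← EReal.coe_le_coe_iff, hcoe]
  · rw [← EReal.coe_lt_coe_iff, hcoe, hqS, sInf_lt_iff] at hx
    obtain ⟨a, ha, hax⟩ := hx
    have ha : 1 - β ≤ (∑ j, if (s j : EReal) ≤ a then ω j else 0) + if a = ⊤ then ωInf else 0 := ha
    rw [if_neg (hax.trans_le le_top).ne, add_zero] at ha
    refine ha.trans (Finset.sum_le_sum fun j _ => ?_)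
    by_cases h : (s j : EReal) ≤ a
    · rw [if_pos h, if_pos (EReal.coe_lt_coe_iff.1 (h.trans_lt hax))]
    · rw [if_neg h]
      split_ifs
      exacts [hω j, le_rfl]

/-- The points with mass at least `1 - β` strictly below them have mass at most `β`: these points
lie above all the points that are below the least of them. -/
lemma sum_mass_below_le {ι : Type*} [Fintype ι] {w a : ι → ℝ} (hβ : 0 ≤ β) (hw : ∀ i, 0 ≤ w i)
    (hsum : ∑ i, w i = 1) :
    ∑ k, (if 1 - β ≤ ∑ i, (if a i < a k then w i else 0) then w k else 0) ≤ β := by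
  by_cases hne : ∃ k, 1 - β ≤ ∑ i, (if a i < a k then w i else 0)
  · set U := Finset.univ.filter fun k => 1 - β ≤ ∑ i, (if a i < a k then w i else 0) with hU
    have hUne : U.Nonempty := by
      obtain ⟨k, hk⟩ := hne
      exact ⟨k, Finset.mem_filter.2 ⟨Finset.mem_univ k, hk⟩⟩
    obtain ⟨k, hkU, hk⟩ := U.exists_min_image a hUne
    have hk' : 1 - β ≤ ∑ i, (if a i < a k then w i else 0) := (Finset.mem_filter.1 hkU).2
    have hadd : ∑ i, (if 1 - β ≤ ∑ j, (if a j < a i then w j else 0) then w i else 0) +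
        ∑ i, (if a i < a k then w i else 0) ≤ ∑ i, w i := by
      rw [← Finset.sum_add_distrib]
      refine Finset.sum_le_sum fun i _ => ?_
      by_cases hi : 1 - β ≤ ∑ j, (if a j < a i then w j else 0)
      · have : a k ≤ a i := hk i (Finset.mem_filter.2 ⟨Finset.mem_univ i, hi⟩)
        rw [if_pos hi, if_neg (not_lt.2 this), add_zero]
      · rw [if_neg hi, zero_add]
        split_ifs
        exacts [le_rfl, hw i]
    linarith
  · push Not at hne
    rw [Finset.sum_congr rfl fun k _ => if_neg (not_le.2 (hne k))]
    simpa using hβ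

end Quantile

/-! ### Coverage of weighted split conformal prediction -/

section Conformal
variable {Ω : Type*} [MeasurableSpace Ω]

/-- Exchanging two coordinates with the same law preserves a product measure. -/
lemma measurePreserving_swap {ι : Type*} [Fintype ι] [DecidableEq ι] (μ : ι → Measure Ω)
    [∀ i, IsProbabilityMeasure (μ i)] {a b : ι} (h : μ a = μ b) :
    MeasurePreserving (fun y : ι → Ω => y ∘ Equiv.swap a b) (Measure.pi μ) (Measure.pi μ) := by
  have hmeas : Measurable fun y : ι → Ω => y ∘ Equiv.swap a b :=
    measurable_pi_lambda _ fun i => measurable_pi_apply _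
  refine ⟨hmeas, (Measure.pi_eq fun s hs => ?_).symm⟩
  rw [Measure.map_apply hmeas (MeasurableSet.univ_pi hs)]
  have : (fun y : ι → Ω => y ∘ Equiv.swap a b) ⁻¹' Set.univ.pi s =
      Set.univ.pi (s ∘ Equiv.swap a b) := by
    ext y
    simp only [Set.mem_preimage, Set.mem_univ_pi, Function.comp_apply]
    exact ⟨fun h i => by simpa using h (Equiv.swap a b i),
      fun h i => by simpa using h (Equiv.swap a b i)⟩
  rw [this, Measure.pi_pi]
  refine Fintype.prod_equiv (Equiv.swap a b) _ _ fun i => ?_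
  simp only [Function.comp_apply]
  congr 1
  rcases eq_or_ne i a with rfl | hia
  · rw [Equiv.swap_apply_left, h]
  · rcases eq_or_ne i b with rfl | hib
    · rw [Equiv.swap_apply_right, h]
    · rw [Equiv.swap_apply_of_ne_of_ne hia hib]

/-- Coverage for independent points `y 0, y 1, …, y n` of which `y 0` is the test point. If the other
points have mass at least `1 - β` below the test point, then exchanging the test point with a point
`k` gives a configuration in which the mass below point `k` is at least `1 - β`, as the test point
has the largest weight. Averaging over `k` with the weights gives the bound `β`. -/
lemma pi_coverage {n : ℕ} (μ : Fin (n + 1) → Measure Ω) [∀ i, IsProbabilityMeasure (μ i)]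
    {score : Ω → ℝ} (hscore : Measurable score) {β : ℝ} (hβ : 0 ≤ β) {w : Fin (n + 1) → ℝ}
    (hw : ∀ i, 0 ≤ w i) (hw0 : ∀ i, w i ≤ w 0) (hsum : ∑ i, w i = 1)
    (hlaw : ∀ i, 0 < w i → μ i = μ 0) :
    (Measure.pi μ).real {y | 1 - β ≤ ∑ i : Fin n,
      if score (y i.succ) < score (y 0) then w i.succ else 0} ≤ β := by
  set E : Fin (n + 1) → Set (Fin (n + 1) → Ω) := fun k =>
    {y | 1 - β ≤ ∑ i, if score (y i) < score (y k) then w i else 0} with hE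
  have hterm : ∀ i j : Fin (n + 1), Measurable fun y : Fin (n + 1) → Ω =>
      if score (y i) < score (y j) then w i else 0 := fun i j =>
    Measurable.ite (measurableSet_lt (hscore.comp (measurable_pi_apply i))
      (hscore.comp (measurable_pi_apply j))) measurable_const measurable_const
  have hEmeas : ∀ k, MeasurableSet (E k) := fun k =>
    measurableSet_le measurable_const (Finset.measurable_sum _ fun i _ => hterm i k)
  set A := {y : Fin (n + 1) → Ω | 1 - β ≤ ∑ i : Fin n,
    if score (y i.succ) < score (y 0) then w i.succ else 0} with hA
  have hAE : ∀ k, 0 < w k → (Measure.pi μ).real A ≤ (Measure.pi μ).real (E k) := fun k hk => by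
    have hmp := measurePreserving_swap μ (a := 0) (b := k) (hlaw k hk).symm
    rw [← hmp.measureReal_preimage (hEmeas k).nullMeasurableSet]
    refine measureReal_mono fun y hy => ?_
    change 1 - β ≤ ∑ i, if score (y (Equiv.swap 0 k i)) < score (y (Equiv.swap 0 k k)) then w i else 0
    rw [Equiv.swap_apply_right]
    have hy : 1 - β ≤ ∑ i : Fin n, if score (y i.succ) < score (y 0) then w i.succ else 0 := hy
    have h0 : ∑ i : Fin n, (if score (y i.succ) < score (y 0) then w i.succ else 0) =
        ∑ i, if score (y i) < score (y 0) then w i else 0 := by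
      rw [Fin.sum_univ_succ]
      simp
    rw [h0] at hy
    refine hy.trans ?_
    rw [← Equiv.sum_comp (Equiv.swap 0 k)
      fun i => if score (y (Equiv.swap 0 k i)) < score (y 0) then w i else 0]
    simp only [Equiv.swap_apply_self]
    refine Finset.sum_le_sum fun i _ => ?_
    split_ifs with h
    · rcases eq_or_ne i 0 with rfl | hi0
      · exact absurd h (lt_irrefl _)
      · rcases eq_or_ne i k with rfl | hik
        · rw [Equiv.swap_apply_right]
          exact hw0 i
        · rw [Equiv.swap_apply_of_ne_of_ne hi0 hik]
    · exact le_rfl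
  have hind : ∀ k, Integrable ((E k).indicator fun _ => w k) (Measure.pi μ) := fun k =>
    (integrable_const _).indicator (hEmeas k)
  calc (Measure.pi μ).real A = ∑ k, w k * (Measure.pi μ).real A := by
        rw [← Finset.sum_mul, hsum, one_mul]
    _ ≤ ∑ k, w k * (Measure.pi μ).real (E k) := Finset.sum_le_sum fun k _ => by
        rcases (hw k).eq_or_lt with h | h
        · rw [← h, zero_mul, zero_mul]
        · exact mul_le_mul_of_nonneg_left (hAE k h) h.le
    _ = ∫ y, ∑ k, (E k).indicator (fun _ => w k) y ∂(Measure.pi μ) := by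
        rw [integral_finsetSum _ fun k _ => hind k]
        refine Finset.sum_congr rfl fun k _ => ?_
        rw [integral_indicator_const _ (hEmeas k), smul_eq_mul, mul_comm]
    _ ≤ ∫ _y, β ∂(Measure.pi μ) := by
        refine integral_mono (integrable_finsetSum _ fun k _ => hind k) (integrable_const β)
          fun y => ?_
        refine le_trans (le_of_eq (Finset.sum_congr rfl fun k _ => ?_))
          (sum_mass_below_le (a := fun i => score (y i)) hβ hw hsum)
        rw [Set.indicator_apply]
        rfl
    _ = β := by simp

/-- Coverage with the test point separate from the calibration points. -/
lemma prod_coverage {n : ℕ} (Q : Fin n → Measure Ω) [∀ j, IsProbabilityMeasure (Q j)]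
    (ν : Measure Ω) [IsProbabilityMeasure ν] {score : Ω → ℝ} (hscore : Measurable score) {β : ℝ}
    (hβ : 0 ≤ β) {ω : Fin n → ℝ} {ωInf : ℝ} (hω : ∀ j, 0 ≤ ω j ∧ ω j ≤ ωInf)
    (hsum : ∑ j, ω j + ωInf = 1) (hlaw : ∀ j, 0 < ω j → Q j = ν) :
    (ν.prod (Measure.pi Q)).real {q | 1 - β ≤ ∑ j,
      if score (q.2 j) < score q.1 then ω j else 0} ≤ β := by
  have hInf : 0 ≤ ωInf := by
    by_contra! h
    have : ∑ j, ω j ≤ 0 := Finset.sum_nonpos fun j _ => ((hω j).2.trans h.le)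
    linarith
  set μ : Fin (n + 1) → Measure Ω := Fin.cons ν Q with hμ
  have hμprob : ∀ i, IsProbabilityMeasure (μ i) := fun i => by
    refine Fin.cases ?_ (fun j => ?_) i
    · rw [hμ, Fin.cons_zero]; infer_instance
    · rw [hμ, Fin.cons_succ]; infer_instance
  have hmp := measurePreserving_piFinSuccAbove μ 0
  have hprod : (μ 0).prod (Measure.pi fun j => μ (Fin.succAbove 0 j)) = ν.prod (Measure.pi Q) := by
    simp only [hμ, Fin.cons_zero, Fin.zero_succAbove, Fin.cons_succ]
  rw [hprod] at hmp
  have hmeas : MeasurableSet {q : Ω × (Fin n → Ω) | 1 - β ≤ ∑ j,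
      if score (q.2 j) < score q.1 then ω j else 0} := by
    refine measurableSet_le measurable_const (Finset.measurable_sum _ fun j _ => ?_)
    exact Measurable.ite (measurableSet_lt
      (hscore.comp ((measurable_pi_apply j).comp measurable_snd)) (hscore.comp measurable_fst))
      measurable_const measurable_const
  rw [← hmp.measureReal_preimage hmeas.nullMeasurableSet]
  refine le_trans (le_of_eq ?_) (pi_coverage μ hscore hβ (w := Fin.cons ωInf ω)
    (fun i => ?_) (fun i => ?_) ?_ fun i => ?_)
  · simp only [Fin.cons_succ]
    rfl
  · refine Fin.cases ?_ (fun j => ?_) i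
    · simpa using hInf
    · simpa using (hω j).1
  · refine Fin.cases ?_ (fun j => ?_) i
    · simp
    · simpa using (hω j).2
  · rw [Fin.sum_univ_succ]
    simp only [Fin.cons_zero, Fin.cons_succ]
    linarith
  · refine Fin.cases ?_ (fun j => ?_) i
    · intro _; rfl
    · simpa [hμ] using hlaw j

end Conformal

/-! ### The history -/

section HistoryData
variable {Z : Type*} [MeasurableSpace Z] [MeasurableSpace TruthfulAuction] {m n : ℕ}
  {learn : (Fin m → DataPoint Z) → Z → I} {β : ℝ} {ω : Fin n → ℝ} {ωInf : ℝ}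

/-- The score `v - μ̂(z)` of a data point, with the predictor fitted to the training data `a`. -/
def score (learn : (Fin m → DataPoint Z) → Z → I) (a : Fin m → DataPoint Z) (y : DataPoint Z) : ℝ :=
  (y.2 : ℝ) - (learn a y.1 : ℝ)

/-- The calibration data have mass at least `1 - β` below the score of the data point `y`. -/
def Uncovered (learn : (Fin m → DataPoint Z) → Z → I) (β : ℝ) (ω : Fin n → ℝ) (D : History Z m n)
    (y : DataPoint Z) : Prop :=
  1 - β ≤ ∑ j, if score learn D.1 (D.2 j) < score learn D.1 y then ω j else 0

omit [MeasurableSpace Z] [MeasurableSpace TruthfulAuction] in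
lemma adjustedValue_spec (hβ : β < 1) (hω : ∀ j, 0 ≤ ω j) (hsum : ∑ j, ω j + ωInf = 1)
    (hInf : ωInf ≤ β) (D : History Z m n) :
    (∀ z, adjustedValue learn β ω ωInf D z ∈ Set.Icc (-1 : ℝ) 2) ∧
      ∀ y : DataPoint Z, adjustedValue learn β ω ωInf D y.1 < y.2 → Uncovered learn β ω D y := by
  obtain ⟨⟨h1, h2⟩, h3⟩ := weightedQuantile_spec
    (s := fun j => ((D.2 j).2 : ℝ) - (learn D.1 (D.2 j).1 : ℝ)) hβ hω hsum hInf fun j =>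
      ⟨by linarith [(D.2 j).2.2.1, (learn D.1 (D.2 j).1).2.2],
        by linarith [(D.2 j).2.2.2, (learn D.1 (D.2 j).1).2.1]⟩
  refine ⟨fun z => ?_, fun y hy => h3 _ ?_⟩
  · rw [adjustedValue]
    exact ⟨by linarith [(learn D.1 z).2.1], by linarith [(learn D.1 z).2.2]⟩
  · rw [adjustedValue] at hy
    simp only [score]
    linarith

omit [MeasurableSpace TruthfulAuction] in
lemma measurable_score
    (hlearn : Measurable fun q : (Fin m → DataPoint Z) × Z => learn q.1 q.2) :
    Measurable fun q : (Fin m → DataPoint Z) × DataPoint Z => score learn q.1 q.2 :=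
  (measurable_subtype_coe.comp (measurable_snd.comp measurable_snd)).sub
    (measurable_subtype_coe.comp
      (hlearn.comp (measurable_fst.prodMk (measurable_fst.comp measurable_snd))))

omit [MeasurableSpace TruthfulAuction] in
lemma measurableSet_uncovered
    (hlearn : Measurable fun q : (Fin m → DataPoint Z) × Z => learn q.1 q.2) :
    MeasurableSet {q : History Z m n × DataPoint Z | Uncovered learn β ω q.1 q.2} := by
  have hs := measurable_score hlearn
  refine measurableSet_le measurable_const (Finset.measurable_sum _ fun j _ => ?_)
  have ha : Measurable fun q : History Z m n × DataPoint Z => q.1.1 :=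
    measurable_fst.comp measurable_fst
  have hy : Measurable fun q : History Z m n × DataPoint Z => q.1.2 j :=
    (measurable_pi_apply j).comp (measurable_snd.comp measurable_fst)
  exact Measurable.ite (measurableSet_lt (hs.comp (ha.prodMk hy)) (hs.comp (ha.prodMk measurable_snd)))
    measurable_const measurable_const

variable (Qtrain : Fin m → Measure (DataPoint Z)) (Qcal : Fin n → Measure (DataPoint Z))
  [∀ i, IsProbabilityMeasure (Qtrain i)] [∀ j, IsProbabilityMeasure (Qcal j)]

omit [MeasurableSpace TruthfulAuction] in
/-- Averaged over the history, a fresh data point with the law of the calibration data is uncovered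
with probability at most `β`. -/
lemma lintegral_uncovered_le
    (hlearn : Measurable fun q : (Fin m → DataPoint Z) × Z => learn q.1 q.2)
    (ν : Measure (DataPoint Z)) [IsProbabilityMeasure ν] (hβ : 0 ≤ β)
    (hω : ∀ j, 0 ≤ ω j ∧ ω j ≤ ωInf) (hsum : ∑ j, ω j + ωInf = 1)
    (hlaw : ∀ j, 0 < ω j → Qcal j = ν) :
    ∫⁻ D, ν {y | Uncovered learn β ω D y} ∂((Measure.pi Qtrain).prod (Measure.pi Qcal)) ≤
      ENNReal.ofReal β := by
  have hset : MeasurableSet {q : History Z m n × DataPoint Z | Uncovered learn β ω q.1 q.2} :=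
    measurableSet_uncovered hlearn
  have hmeas : Measurable fun D : History Z m n => ν {y | Uncovered learn β ω D y} :=
    measurable_measure_prodMk_left hset
  rw [lintegral_prod _ hmeas.aemeasurable]
  calc ∫⁻ a, ∫⁻ d, ν {y | Uncovered learn β ω (a, d) y} ∂(Measure.pi Qcal) ∂(Measure.pi Qtrain)
      ≤ ∫⁻ _a, ENNReal.ofReal β ∂(Measure.pi Qtrain) := lintegral_mono fun a => ?_
    _ = ENNReal.ofReal β := by simp
  have hmap : Measurable fun q : DataPoint Z × (Fin n → DataPoint Z) =>
      (((a, q.2), q.1) : History Z m n × DataPoint Z) :=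
    (measurable_const.prodMk measurable_snd).prodMk measurable_fst
  have hset' := hmap hset
  have h := prod_coverage Qcal ν (score := score learn a)
    ((measurable_score hlearn).comp (measurable_const.prodMk measurable_id)) hβ hω hsum hlaw
  rw [measureReal_def] at h
  have h2 := (ENNReal.le_ofReal_iff_toReal_le (measure_ne_top _ _) hβ).2 h
  refine le_trans (le_of_eq ?_) h2
  exact (Measure.prod_apply_symm hset').symm

end HistoryData

/-! ### Good histories and the theorem -/

section GoodHistories
variable {Z : Type*} [MeasurableSpace Z] [MeasurableSpace TruthfulAuction] {T m n : ℕ}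

lemma measurable_dataPoint : Measurable (Request.dataPoint : Request Z → DataPoint Z) :=
  measurable_fst.prodMk (measurable_fst.comp measurable_snd)

/-- By coverage and Markov's inequality, with probability at least `1 - α` over the history, the
conditional expectation of the number of underestimated rounds is at most one. -/
lemma exists_good_histories {α : ℝ} (hT : 1 ≤ T) (hα : 0 < α) (hα1 : α < 1)
    (Qtrain : Fin m → Measure (DataPoint Z)) (Qcal : Fin n → Measure (DataPoint Z))
    (P : Fin T → Measure (Request Z)) [∀ i, IsProbabilityMeasure (Qtrain i)]
    [∀ j, IsProbabilityMeasure (Qcal j)] [∀ t, IsProbabilityMeasure (P t)]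
    {learn : (Fin m → DataPoint Z) → Z → I}
    (hlearn : Measurable fun q : (Fin m → DataPoint Z) × Z => learn q.1 q.2)
    {ω : Fin T → Fin n → ℝ} {ωInf : Fin T → ℝ}
    (hω : ∀ t, AdmissibleWeights (α / T) Qcal (P t) (ω t) (ωInf t)) :
    ∃ G : Set (History Z m n), MeasurableSet G ∧
      1 - α ≤ ((Measure.pi Qtrain).prod (Measure.pi Qcal)).real G ∧
      ∀ D ∈ G, ∑ t, (P t).real
        {x | adjustedValue learn (α / T) (ω t) (ωInf t) D x.feature < x.value} ≤ 1 := by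
  have hT0 : (0 : ℝ) < T := by exact_mod_cast hT
  have hβ0 : 0 ≤ α / T := by positivity
  have hβ1 : α / T < 1 := by
    rw [div_lt_one hT0]
    have : (1 : ℝ) ≤ T := by exact_mod_cast hT
    linarith
  set μ := (Measure.pi Qtrain).prod (Measure.pi Qcal) with hμ
  set ν : Fin T → Measure (DataPoint Z) := fun t => (P t).map Request.dataPoint with hν
  have hνprob : ∀ t, IsProbabilityMeasure (ν t) := fun t =>
    Measure.isProbabilityMeasure_map measurable_dataPoint.aemeasurable
  set S : History Z m n → ENNReal := fun D =>
    ∑ t, ν t {y | Uncovered learn (α / T) (ω t) D y} with hS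
  have hmeas : ∀ t, Measurable fun D : History Z m n =>
      ν t {y | Uncovered learn (α / T) (ω t) D y} := fun t =>
    measurable_measure_prodMk_left (measurableSet_uncovered hlearn)
  have hSmeas : Measurable S := Finset.measurable_sum _ fun t _ => hmeas t
  have hSint : ∫⁻ D, S D ∂μ ≤ ENNReal.ofReal α := by
    rw [lintegral_finsetSum _ fun t _ => hmeas t]
    calc ∑ t, ∫⁻ D, ν t {y | Uncovered learn (α / T) (ω t) D y} ∂μ
        ≤ ∑ _t : Fin T, ENNReal.ofReal (α / T) := Finset.sum_le_sum fun t _ =>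
          lintegral_uncovered_le Qtrain Qcal hlearn (ν t) hβ0 (hω t).1 (hω t).2.1 (hω t).2.2.1
      _ = ENNReal.ofReal α := by
          rw [← ENNReal.ofReal_sum_of_nonneg fun _ _ => hβ0]
          congr 1
          simp only [Finset.sum_const, Finset.card_univ, Fintype.card_fin, nsmul_eq_mul]
          field_simp
  have hGmeas : MeasurableSet {D | S D < 1} := measurableSet_lt hSmeas measurable_const
  refine ⟨{D | S D < 1}, hGmeas, ?_, fun D hD => ?_⟩
  · have h1 : μ {D | 1 ≤ S D} ≤ ENNReal.ofReal α := by
      have := mul_meas_ge_le_lintegral (μ := μ) hSmeas 1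
      rw [one_mul] at this
      exact this.trans hSint
    have h2 : μ.real {D | 1 ≤ S D} ≤ α := (ENNReal.le_ofReal_iff_toReal_le (measure_ne_top _ _)
      hα.le).1 h1
    have h3 : {D | S D < 1}ᶜ = {D | 1 ≤ S D} := by
      ext D
      simp
    have h4 := probReal_compl_eq_one_sub (μ := μ) hGmeas
    rw [h3] at h4
    linarith
  · have hD : S D < 1 := hD
    have h1 : ∀ t, (P t).real
        {x | adjustedValue learn (α / T) (ω t) (ωInf t) D x.feature < x.value} ≤
        (ν t).real {y | Uncovered learn (α / T) (ω t) D y} := fun t => by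
      have hset : MeasurableSet {y | Uncovered learn (α / T) (ω t) D y} :=
        (measurable_const.prodMk measurable_id) (measurableSet_uncovered (n := n) hlearn)
      rw [hν, map_measureReal_apply measurable_dataPoint hset]
      exact measureReal_mono fun x hx => (adjustedValue_spec hβ1 (fun j => ((hω t).1 j).1)
        (hω t).2.1 (hω t).2.2.2 D).2 x.dataPoint hx
    refine (Finset.sum_le_sum fun t _ => h1 t).trans ?_
    simp only [measureReal_def]
    rw [← ENNReal.toReal_sum fun t _ => measure_ne_top _ _]
    exact ENNReal.toReal_le_of_le_ofReal zero_le_one (by simpa using hD.le)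

end GoodHistories

theorem theorem4 (c C K : ℝ) (hc : 0 < c) :
    ∃ M : ℝ, ∀ (Z : Type*) [MeasurableSpace Z] [MeasurableSpace TruthfulAuction],
      -- the winning probability and the payment are jointly measurable in the auction and the bid
      Measurable (fun q : TruthfulAuction × ℝ≥0 => q.1.alloc q.2) →
      Measurable (fun q : TruthfulAuction × ℝ≥0 => q.1.pay q.2) →
      ∀ (T m n : ℕ) (B α : ℝ), 1 ≤ T → 0 < α → α < 1 → c ≤ B / T → B / T ≤ C →
      -- laws of the training data, of the calibration data and of the requests
      ∀ (Qtrain : Fin m → Measure (DataPoint Z)) (Qcal : Fin n → Measure (DataPoint Z))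
        (P : Fin T → Measure (Request Z)),
      (∀ i, IsProbabilityMeasure (Qtrain i)) → (∀ j, IsProbabilityMeasure (Qcal j)) →
      (∀ t, IsProbabilityMeasure (P t)) →
      (∀ t, ∀ᵐ γ ∂(P t), 0 < γ.value) →
      meanDeviation P ≤ K →
      ∀ (learn : (Fin m → DataPoint Z) → Z → I),
      Measurable (fun q : (Fin m → DataPoint Z) × Z => learn q.1 q.2) →
      ∀ (ω : Fin T → Fin n → ℝ) (ωInf : Fin T → ℝ),
      (∀ t, AdmissibleWeights (α / T) Qcal (P t) (ω t) (ωInf t)) →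
      -- reward, with probability at least `1 - α` over the history
      (∃ G : Set (History Z m n), MeasurableSet G ∧
        1 - α ≤ ((Measure.pi Qtrain).prod (Measure.pi Qcal)).real G ∧
        ∀ D ∈ G, ExpectationLE (Measure.pi P)
          (fun γ =>
            1 / (1 + xi (adjustedValues learn (α / T) ω ωInf D γ) γ) * optReward B γ -
              reward (algBids B (adjustedValues learn (α / T) ω ωInf D γ) γ) γ)
          (M * √(T : ℝ))) ∧
      -- budget and RoS constraints, for every history and every sequence of requests
      (∀ (D : History Z m n) (γ : Fin T → Request Z),
        payment (algBids B (adjustedValues learn (α / T) ω ωInf D γ) γ) γ ≤ B) ∧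
      (∀ (D : History Z m n) (γ : Fin T → Request Z), 2 ≤ T → (∀ t, 0 < (γ t).value) →
        payment (algBids B (adjustedValues learn (α / T) ω ωInf D γ) γ) γ -
          (1 + xi (adjustedValues learn (α / T) ω ωInf D γ) γ) *
            reward (algBids B (adjustedValues learn (α / T) ω ωInf D γ) γ) γ
          ≤ M * (√(T : ℝ) * Real.log T)) := by
  refine ⟨7 + (1 + 32 * K + 2 * (19 + C) + 2 * (3 / c + 5 / c ^ 2 + 125)), ?_⟩
  intro Z _ _ halloc hpay T m n B α hT hα hα1 hcB hBC Qtrain Qcal P hQtrain hQcal hP hpos hMD learn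
    hlearn ω ωInf hω
  have hT0 : (0 : ℝ) < T := by exact_mod_cast hT
  have hs1 : 1 ≤ √(T : ℝ) := Real.one_le_sqrt.2 (by exact_mod_cast hT)
  have hC : 0 ≤ C := (hc.le.trans hcB).trans hBC
  have hB : 0 ≤ B := by
    have := mul_nonneg (hc.le.trans hcB) hT0.le
    rwa [div_mul_cancel₀ _ hT0.ne'] at this
  have hK : 0 ≤ K := le_trans (Finset.sum_nonneg fun t _ => tvDist_nonneg) hMD
  have hβ1 : α / T < 1 := by
    rw [div_lt_one hT0]
    have : (1 : ℝ) ≤ T := by exact_mod_cast hT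
    linarith
  have hc1 : 0 ≤ 3 / c := by positivity
  have hc2 : 0 ≤ 5 / c ^ 2 := by positivity
  have hadj : ∀ (D : History Z m n) t z,
      adjustedValue learn (α / T) (ω t) (ωInf t) D z ∈ Set.Icc (-1 : ℝ) 2 := fun D t z =>
    (adjustedValue_spec hβ1 (fun j => ((hω t).1 j).1) (hω t).2.1 (hω t).2.2.2 D).1 z
  refine ⟨?_, fun D γ => sum_pay_le B _ _ hB, fun D γ hT2 hγ => ?_⟩
  · obtain ⟨G, hG, hGα, hGood⟩ := exists_good_histories hT hα hα1 Qtrain Qcal P hlearn hω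
    refine ⟨G, hG, hGα, fun D hD => ?_⟩
    have hmeas : ∀ t, Measurable (adjustedValue learn (α / T) (ω t) (ωInf t) D) := fun t =>
      (measurable_subtype_coe.comp
        (hlearn.comp (measurable_const.prodMk measurable_id))).add measurable_const
    obtain ⟨h, hint, hle, hexp⟩ := expectationLE_regret halloc hpay P
      (vh := fun t => adjustedValue learn (α / T) (ω t) (ωInf t) D) hmeas (hadj D) hT hc hcB hBC
      hpos hMD (hGood D hD)
    exact ⟨h, hint, hle, hexp.trans (mul_le_mul_of_nonneg_right (by linarith) (by linarith))⟩
  · refine (sum_violation_le hT (fun t => (hadj D t _).2) hγ).trans ?_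
    have hlog : 1 / 2 ≤ Real.log T := by
      have h1 : Real.log 2 ≤ Real.log T := Real.log_le_log two_pos (by exact_mod_cast hT2)
      linarith [Real.log_two_gt_d9]
    have h1 : √(T : ℝ) * (1 / 2) ≤ √(T : ℝ) * Real.log T :=
      mul_le_mul_of_nonneg_left hlog (by linarith)
    have h2 : 0 ≤ √(T : ℝ) * Real.log T := by linarith
    have h3 : 0 ≤ (1 + 32 * K + 2 * (19 + C) + 2 * (3 / c + 5 / c ^ 2 + 125)) *
        (√(T : ℝ) * Real.log T) := by positivity
    linarith
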